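/- **Time complexity of sequential Monte Carlo (SMC) with the optimal proposal.** *Setting.* Let $\mathcal S_0$ be a prompt space and $\mathcal S_1,\mathcal S_2,\dots$ discrete state spaces; put $\mathcal S_{1:0}=\{\varnothing\}$ and $\mathcal S_{1:t}=\mathcal S_{1:t-1}\times\mathcal S_t$. Fix a prompt $s_0$, a base model $\pi_{\rm ref}(\cdot\mid s_0,s_{1:t})$ (a probability law on $\mathcal S_{t+1}$ for each prefix $s_{1:t}$), a reward model $\hat V(s_0,s_{1:t})>0$ on prefixes, and a horizon $T\ge1$. The target is $\tilde\pi_T(s_{1:T})\propto\pi_{\rm ref}(s_{1:T}\mid s_0)\,\hat V(s_0,s_{1:T})$. Write $Z(s_{1:t})=\mathbb E_{s_{t+1}\sim\pi_{\rm ref}(\cdot\mid s_0,s_{1:t})}[\hat V(s_0,s_{1:t+1})]$. Assume that for all $0\le t<T$ and all $s_{1:t+1}$: 1. (ratio bound) $\max\big\{\hat V(s_0,s_{1:t})/\hat V(s_0,s_{1:t+1}),\ \hat V(s_0,s_{1:t+1})/\hat V(s_0,s_{1:t})\big\}\le L$ (so $L\ge1$); 2. (Bellman error bound) $\max\big\{\hat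 V(s_0,s_{1:t})/Z(s_{1:t}),\ Z(s_{1:t})/\hat V(s_0,s_{1:t})\big\}\le1+\varepsilon$, where $\varepsilon\ge0$. *Rejection sampling.* Given a score $g\ge0$, a law $\mu$, a threshold $M$ and a failure probability $\delta'$, let $n=\lceil 4M\log(4/\delta')\rceil$ and let $\widehat Z$ be the mean of $g$ over $n$ i.i.d. draws from $\mu$. Then make at most $n$ independent trials: draw $z\sim\mu$ and accept it with probability $\min\{g(z)/(M\widehat Z),1\}$. Return the first accepted $z$; if none is accepted, return a fresh draw from $\mu$. *Sampler.* It has parameters $N,N_m\ge1$, $M>0$ and $\delta'$, and starts with $N$ empty prefixes. For $t=0,\dots,T-1$, given particles $x_1,\dots,x_N\in\mathcal S_{1:t}$: - (propagate) for each $i$, draw $y_i$ by rejection sampling with score $\hat V(s_0,(x_i,\cdot))$, law $\pi_{\rm ref}(\cdot\mid s_0,x_i)$ and parameters $M,\delta'$; - (weights) for each $j$, let $\widehat Z_j$ be the mean of $\hat V(s_0,(x_j,\cdot))$ over $N_m$ fresh i.i.d. draws from $\pi_{\rm ref}(\cdot\mid s_0,x_j)$, and put $w_j=\widehat Z_j/\hat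 V(s_0,x_j)$; - (resample) draw indices $A_1,\dots,A_N$ i.i.d. with $\mathbb P(A_i=j)=w_j/\sum_\ell w_\ell$; the new particles are $(x_{A_i},y_{A_i})$, $i=1,\dots,N$. After the last round it outputs one of the $N$ particles, chosen uniformly at random. All draws are independent given the past. The *time* of a run counts one unit for each draw from the base model, evaluation of $\hat V$, accept/reject coin, weight, and drawn index. $\hat\pi_T|_{\mathcal E}$ denotes the law of the output conditioned on an event $\mathcal E$, and $\|\cdot\|_{\rm TV}$ is the total variation distance $\frac12\sum|\cdot|$. *Claim.* For all constants $c_1,c_2,c_3>0$ there are constants $C>0$, $K\ge1$, $k\in\mathbb N$, depending only on $c_1,c_2,c_3$, such that the following holds. Let $T\ge1$, $L\ge1$, $0\le\varepsilon\le c_1/T$, $0<\delta_{\rm TV}\le c_2$, $0<\delta\le\min\{c_3\delta_{\rm TV},\tfrac12\}$. Then there are $N,N_m\ge1$ and $M>0$, depending only on these numbers and not on the spaces, $\pi_{\rm ref}$, $\hat V$ or $s_0$, such that for every model satisfying 1 and 2 the sampler with $\delta'=\delta/(KNT)$ has the following two properties: every run takes time at most $$C\Big(1+\log\big(1+\tfrac{T}{\delta_{\rm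 TV}}\big)\Big)^{k}\Big(\frac{\varepsilon L T^5}{\delta_{\rm TV}^3}+LT\Big)\log\frac1\delta ,$$ and there is an event $\mathcal E$ with $\mathbb P(\mathcal E)\ge1-\delta$ and $\|\tilde\pi_T-\hat\pi_T|_{\mathcal E}\|_{\rm TV}\le\delta_{\rm TV}$. In particular, the time is $\tilde O\big(\varepsilon LT^5\log(\delta^{-1})/\delta_{\rm TV}^3\big)$ as soon as $\varepsilon T^4\ge\delta_{\rm TV}^3$. -/

import Mathlib

open scoped ENNReal NNReal

universe u v

noncomputable section

namespace OptSMC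

/-! ### Elementary random choices -/

/-- The law of a vector of independent variables with laws `p 0, …, p (n-1)`. -/
def indep {α : Type v} : (n : ℕ) → (Fin n → PMF α) → PMF (Fin n → α)
  | 0, _ => PMF.pure Fin.elim0
  | n + 1, p => (p 0).bind fun x => (indep n fun i => p i.succ).map fun xs => Fin.cons x xs

/-- The probability law proportional to the weights `w`. The law `fallback` is used only when the
weights cannot be normalized (total weight `0` or `∞`). -/
def normalizeOr {α : Type v} (fallback : PMF α) (w : α → ℝ≥0∞) : PMF α :=
  open Classical in
  if h : (∑' a, w a) ≠ 0 ∧ (∑' a, w a) ≠ ∞ then PMF.normalize w h.1 h.2 else fallback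

/-- The tilted law `ν(a) ∝ μ(a) g(a)`. -/
def tilt {α : Type v} (μ : PMF α) (g : α → ℝ) : PMF α :=
  normalizeOr μ fun a => μ a * ENNReal.ofReal (g a)

/-- The categorical law on `{0, …, N-1}` with probabilities proportional to `w`. -/
def categorical {N : ℕ} [NeZero N] (w : Fin N → ℝ) : PMF (Fin N) :=
  normalizeOr (PMF.uniformOfFintype (Fin N)) fun j => ENNReal.ofReal (w j)

/-- A Bernoulli variable with success probability `min {p, 1}` (for `p ≥ 0`). -/
def coin (p : ℝ) : PMF Bool :=
  PMF.bernoulli (min p.toNNReal 1) (min_le_right _ _)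

/-- Total variation distance of two discrete laws. -/
def tvDist {α : Type v} (μ ν : PMF α) : ℝ :=
  (1 / 2) * ∑' a, |(μ a).toReal - (ν a).toReal|

/-! ### Rejection sampling -/

/-- Everything drawn in one call of rejection sampling with trial budget `n`: the draws for the
empirical normalizer, the trials (proposal, accept bit), and the draw for the failure case. All
trials are recorded; those after the first acceptance are not executed, hence not charged in
`RSRun.time`. -/
structure RSRun (α : Type v) (n : ℕ) : Type v where
  norm : Fin n → α
  trial : Fin n → α × Bool
  last : α

namespace RSRun
variable {α : Type v} {n : ℕ}

/-- Index of the first accepted trial, if there is one. -/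
def firstAccept (r : RSRun α n) : Option (Fin n) :=
  (List.finRange n).find? fun i => (r.trial i).2

/-- The returned sample. -/
def out (r : RSRun α n) : α :=
  match r.firstAccept with
  | some i => (r.trial i).1
  | none => r.last

/-- Unit cost for each base draw, each evaluation of the score, and each coin. -/
def time (r : RSRun α n) : ℕ :=
  2 * n + match r.firstAccept with
    | some i => 3 * ((i : ℕ) + 1)
    | none => 3 * n + 1

end RSRun

/-- The trial budget `4 M log (4 / δ)`, rounded up. -/
def rsBudget (M δ : ℝ) : ℕ := ⌈4 * M * Real.log (4 / δ)⌉₊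

/-- Rejection sampling for the law `∝ g μ`, with threshold `M` and trial budget `n`: estimate the
normalizer by the mean `Ẑ` of `n` scores, then accept a proposal `z ∼ μ` with probability
`min {g z / (M Ẑ), 1}`, at most `n` times; if nothing is accepted, return a fresh draw of `μ`. -/
def rejectionSampling {α : Type v} (g : α → ℝ) (μ : PMF α) (M : ℝ) (n : ℕ) : PMF (RSRun α n) :=
  (indep n fun _ => μ).bind fun zs =>
    (indep n fun _ => μ.bind fun z =>
      (coin (g z / (M * ((∑ i, g (zs i)) / n)))).map fun b => (z, b)).bind fun tr =>
        μ.map fun z => ⟨zs, tr, z⟩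

/-! ### Reasoning model -/

/-- The prefix space `S_{1:t} = S_{1:t-1} × S_t`, with `S_{1:0}` a point. (`S 0` is the space of
prompts.) -/
def Pref (S : ℕ → Type u) : ℕ → Type u
  | 0 => PUnit
  | t + 1 => Pref S t × S (t + 1)

/-- The base model `π_ref(s_{t+1} | s_0, s_{1:t})` and the reward model `V(s_0, s_{1:t})`. -/
structure Model (S : ℕ → Type u) where
  ref : S 0 → (t : ℕ) → Pref S t → PMF (S (t + 1))
  V : S 0 → (t : ℕ) → Pref S t → ℝ

namespace Model
variable {S : ℕ → Type u}

/-- The law `π_ref(s_{1:t} | s_0)` of a prefix under the base model. -/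
def refLaw (m : Model S) (s₀ : S 0) : (t : ℕ) → PMF (Pref S t)
  | 0 => PMF.pure PUnit.unit
  | t + 1 => (m.refLaw s₀ t).bind fun x => (m.ref s₀ t x).map fun y => (x, y)

/-- The target `π̃_t(s_{1:t} | s_0) ∝ π_ref(s_{1:t} | s_0) V(s_0, s_{1:t})`. -/
def target (m : Model S) (s₀ : S 0) (t : ℕ) : PMF (Pref S t) :=
  tilt (m.refLaw s₀ t) (m.V s₀ t)

/-- `V(s_0, (s_{1:t}, ·))` as a function of the next state. -/
def nextV (m : Model S) (s₀ : S 0) (t : ℕ) (x : Pref S t) (y : S (t + 1)) : ℝ :=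
  m.V s₀ (t + 1) (x, y)

/-- `E_{s_{t+1} ∼ π_ref(· | s_0, s_{1:t})} V(s_0, s_{1:t+1})`. -/
def expNext (m : Model S) (s₀ : S 0) (t : ℕ) (x : Pref S t) : ℝ :=
  ∑' y, (m.ref s₀ t x y).toReal * m.nextV s₀ t x y

/-- The reward model is positive up to the horizon, and one step changes it by at most a
factor `L`. -/
def RatioBound (m : Model S) (s₀ : S 0) (T : ℕ) (L : ℝ) : Prop :=
  (∀ t ≤ T, ∀ x, 0 < m.V s₀ t x) ∧
  ∀ t < T, ∀ (x : Pref S t) (y : S (t + 1)),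
    max (m.V s₀ t x / m.nextV s₀ t x y) (m.nextV s₀ t x y / m.V s₀ t x) ≤ L

/-- The one-step Bellman error is at most `ε`, at every prefix that has a next step. -/
def BellmanBound (m : Model S) (s₀ : S 0) (T : ℕ) (ε : ℝ) : Prop :=
  ∀ t < T, ∀ x : Pref S t,
    max (m.V s₀ t x / m.expNext s₀ t x) (m.expNext s₀ t x / m.V s₀ t x) ≤ 1 + ε

end Model

/-! ### Sequential Monte Carlo with the optimal proposal

One round = propagate every particle by rejection sampling, estimate the incremental weights by
Monte Carlo, resample. The resampling that opens step `t + 1` of the usual presentation closes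
round `t` here, so that the last round contains the terminal resampling and the `N` particles
before the first round are all the empty prefix. -/

/-- Everything drawn in one round: the rejection-sampling runs, the Monte-Carlo samples, and the
ancestor indices. -/
structure Round (α : Type v) (N Nm n : ℕ) : Type v where
  rs : Fin N → RSRun α n
  mc : Fin N → Fin Nm → α
  anc : Fin N → Fin N

/-- Cost of a round: the rejection-sampling runs; per particle `Nm` base draws, `Nm` reward
evaluations, one reward evaluation at the old prefix and one weight; one ancestor draw per
particle. -/
def Round.time {α : Type v} {N Nm n : ℕ} (r : Round α N Nm n) : ℕ :=
  (∑ i, (r.rs i).time) + N * (2 * Nm + 2) + N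

/-- Everything drawn in the first `t` rounds. -/
def Hist (S : ℕ → Type u) (N Nm n : ℕ) : ℕ → Type u
  | 0 => PUnit
  | t + 1 => Hist S N Nm n t × Round (S (t + 1)) N Nm n

/-- The particles after `t` rounds (after resampling). -/
def particles {S : ℕ → Type u} {N Nm n : ℕ} :
    (t : ℕ) → Hist S N Nm n t → Fin N → Pref S t
  | 0, _ => fun _ => PUnit.unit
  | t + 1, (h, r) => fun i => (particles t h (r.anc i), (r.rs (r.anc i)).out)

/-- The cost of the first `t` rounds. -/
def histTime {S : ℕ → Type u} {N Nm n : ℕ} : (t : ℕ) → Hist S N Nm n t → ℕ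
  | 0, _ => 0
  | t + 1, (h, r) => histTime t h + r.time

namespace Model
variable {S : ℕ → Type u}

/-- The law of a round that starts from the particles `x`. The weight of particle `j` is the
Monte-Carlo estimate of `E V(s_0, (x_j, ·))` divided by `V(s_0, x_j)`. -/
def roundLaw (m : Model S) (s₀ : S 0) (t N Nm n : ℕ) [NeZero N] (M : ℝ)
    (x : Fin N → Pref S t) : PMF (Round (S (t + 1)) N Nm n) :=
  (indep N fun i => rejectionSampling (m.nextV s₀ t (x i)) (m.ref s₀ t (x i)) M n).bind fun rs =>
    (indep N fun j => indep Nm fun _ => m.ref s₀ t (x j)).bind fun mc =>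
      (indep N fun _ => categorical fun j =>
        ((∑ k, m.nextV s₀ t (x j) (mc j k)) / Nm) / m.V s₀ t (x j)).map fun anc =>
          ⟨rs, mc, anc⟩

/-- The law of the first `t` rounds. -/
def histLaw (m : Model S) (s₀ : S 0) (N Nm n : ℕ) [NeZero N] (M : ℝ) :
    (t : ℕ) → PMF (Hist S N Nm n t)
  | 0 => PMF.pure PUnit.unit
  | t + 1 => (histLaw m s₀ N Nm n M t).bind fun h =>
      (m.roundLaw s₀ t N Nm n M (particles t h)).map fun r => (h, r)

end Model

/-- A complete run: all draws of the `T` rounds and the uniform index of the output particle. -/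
abbrev Run (S : ℕ → Type u) (T N Nm n : ℕ) : Type u := Hist S N Nm n T × Fin N

/-- The law of a complete run of the sampler with `N` particles, `Nm` Monte-Carlo samples per
weight, and rejection sampling with threshold `M` and failure probability `δ'`. -/
def Model.smc {S : ℕ → Type u} (m : Model S) (s₀ : S 0) (T N Nm : ℕ) [NeZero N] (M δ' : ℝ) :
    PMF (Run S T N Nm (rsBudget M δ')) :=
  (m.histLaw s₀ N Nm (rsBudget M δ') M T).bind fun h =>
    (PMF.uniformOfFintype (Fin N)).map fun i => (h, i)

/-- The output trajectory of a run. -/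
def Run.out {S : ℕ → Type u} {T N Nm n : ℕ} (ω : Run S T N Nm n) : Pref S T :=
  particles T ω.1 ω.2

/-- The running time of a run: the cost of its rounds and of the output index. -/
def Run.time {S : ℕ → Type u} {T N Nm n : ℕ} (ω : Run S T N Nm n) : ℕ :=
  histTime T ω.1 + 1

end OptSMC

end

/-!
Replace rejection sampling by exact draws from the optimal proposal and attach to the particle
system the weight `W` that accumulates the mean particle weights. One step of this ideal system acts
in expectation as the Feynman–Kac operator of the model, so the target is the law of the output
under the `W`-weighted measure, and its distance to the plain output law is at most
`1 - E min (W / E W) 1`.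

The Bellman error bound keeps the expected products of future reward ratios within a factor
`exp (ε T)` of `1`. A step therefore multiplies the second moment of `W`, suitably continued by
these products, by at most `(1 + O(1 / N)) ^ 3`, one factor for each source of randomness. Hence the
relative variance of `W` is `O(T / N)` and `N` of order `T / δTV ^ 2` particles suffice. If
`ε T ≤ δTV / 4`, a single particle is enough: its weight is deterministically within `exp (2 ε T)`
of its mean.

By Chernoff bounds, rejection sampling with parameters `M, δ'` returns an optimal-proposal draw with
probability at least `1 - δ'`, so replacing the ideal system by the sampler costs at most `N T δ'`
in total variation.
-/

namespace OptSMC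

/-! ### Expectations and total variation -/

section Expect
variable {α β : Type*}

/-- The expectation of a nonnegative function under a discrete law. Values in `ℝ≥0∞` make every
expectation meaningful and every exchange of sums unconditional. -/
noncomputable def expect (p : PMF α) (f : α → ℝ≥0∞) : ℝ≥0∞ := ∑' a, p a * f a

lemma expect_pure (a : α) (f : α → ℝ≥0∞) : expect (PMF.pure a) f = f a := by
  rw [expect, tsum_eq_single a fun b hb => by simp [hb]]
  simp

lemma expect_bind (p : PMF α) (k : α → PMF β) (f : β → ℝ≥0∞) :
    expect (p.bind k) f = expect p fun a => expect (k a) f := by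
  simp only [expect, PMF.bind_apply, ← ENNReal.tsum_mul_right, ← ENNReal.tsum_mul_left]
  rw [ENNReal.tsum_comm]
  simp only [mul_assoc]

lemma expect_map (p : PMF α) (k : α → β) (f : β → ℝ≥0∞) :
    expect (p.map k) f = expect p fun a => f (k a) := by
  rw [← PMF.bind_pure_comp, expect_bind]
  simp only [Function.comp, expect_pure]

lemma expect_const (p : PMF α) (c : ℝ≥0∞) : expect p (fun _ => c) = c := by
  rw [expect, ENNReal.tsum_mul_right, p.tsum_coe, one_mul]

lemma expect_add (p : PMF α) (f g : α → ℝ≥0∞) :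
    expect p (fun a => f a + g a) = expect p f + expect p g := by
  simp only [expect, mul_add, ENNReal.tsum_add]

lemma expect_mul_left (p : PMF α) (c : ℝ≥0∞) (f : α → ℝ≥0∞) :
    expect p (fun a => c * f a) = c * expect p f := by
  simp only [expect, ← ENNReal.tsum_mul_left, mul_left_comm]

lemma expect_mul_right (p : PMF α) (c : ℝ≥0∞) (f : α → ℝ≥0∞) :
    expect p (fun a => f a * c) = expect p f * c := by
  simp only [expect, ← ENNReal.tsum_mul_right, mul_assoc]

lemma expect_tsum {ι : Type*} (p : PMF α) (f : ι → α → ℝ≥0∞) :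
    expect p (fun a => ∑' i, f i a) = ∑' i, expect p (f i) := by
  simp only [expect, ← ENNReal.tsum_mul_left]
  exact ENNReal.tsum_comm

lemma expect_sum {ι : Type*} (p : PMF α) (s : Finset ι) (f : ι → α → ℝ≥0∞) :
    expect p (fun a => ∑ i ∈ s, f i a) = ∑ i ∈ s, expect p (f i) := by
  simp only [expect, Finset.mul_sum]
  exact Summable.tsum_finsetSum fun _ _ => ENNReal.summable

lemma expect_mono (p : PMF α) {f g : α → ℝ≥0∞} (h : ∀ a, f a ≤ g a) :
    expect p f ≤ expect p g :=
  ENNReal.tsum_le_tsum fun a => by gcongr; exact h a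

lemma expect_le (p : PMF α) {f : α → ℝ≥0∞} {c : ℝ≥0∞} (h : ∀ a, f a ≤ c) : expect p f ≤ c :=
  (expect_mono p h).trans_eq (expect_const p c)

lemma le_expect_of_support (p : PMF α) {f : α → ℝ≥0∞} {c : ℝ≥0∞} (h : ∀ a ∈ p.support, c ≤ f a) :
    c ≤ expect p f := by
  rw [← expect_const p c]
  refine ENNReal.tsum_le_tsum fun a => ?_
  by_cases ha : p a = 0
  · simp [ha]
  · gcongr
    exact h a ha

lemma toOuterMeasure_le_expect (p : PMF α) {A : Set α} {f : α → ℝ≥0∞} (h : ∀ a ∈ A, 1 ≤ f a) :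
    p.toOuterMeasure A ≤ expect p f := by
  rw [PMF.toOuterMeasure_apply]
  refine ENNReal.tsum_le_tsum fun a => ?_
  by_cases ha : a ∈ A
  · rw [Set.indicator_of_mem ha]
    exact le_mul_of_one_le_right' (h a ha)
  · simp [ha]

end Expect

section TotalVariation
variable {α Ω : Type*}

lemma summable_toReal (p : PMF α) : Summable fun a => (p a).toReal :=
  ENNReal.summable_toReal p.tsum_coe_ne_top

lemma tsum_toReal (p : PMF α) : ∑' a, (p a).toReal = 1 := by
  rw [← ENNReal.tsum_toReal_eq p.apply_ne_top, p.tsum_coe, ENNReal.toReal_one]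

lemma tvDist_triangle (μ ν ξ : PMF α) : tvDist μ ξ ≤ tvDist μ ν + tvDist ν ξ := by
  have summable_abs_sub (p q : PMF α) : Summable fun a => |(p a).toReal - (q a).toReal| :=
    ((summable_toReal p).sub (summable_toReal q)).abs
  have hsum : ∑' a, |(μ a).toReal - (ξ a).toReal| ≤
      ∑' a, |(μ a).toReal - (ν a).toReal| + ∑' a, |(ν a).toReal - (ξ a).toReal| := by
    rw [← (summable_abs_sub μ ν).tsum_add (summable_abs_sub ν ξ)]
    exact (summable_abs_sub μ ξ).tsum_le_tsum (fun a => abs_sub_le _ _ _)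
      ((summable_abs_sub μ ν).add (summable_abs_sub ν ξ))
  simp only [tvDist]
  linarith

lemma tvDist_le_of_minorant {μ ν : PMF α} {m : α → ℝ≥0∞} {d : ℝ≥0}
    (hμ : ∀ a, m a ≤ μ a) (hν : ∀ a, m a ≤ ν a) (hm : 1 ≤ ∑' a, m a + d) :
    tvDist μ ν ≤ d := by
  have hm_top : ∑' a, m a ≠ ∞ :=
    ne_top_of_le_ne_top μ.tsum_coe_ne_top (ENNReal.tsum_le_tsum hμ)
  have mass_m : 1 ≤ ∑' a, (m a).toReal + d := by
    rw [← ENNReal.tsum_toReal_eq (ENNReal.ne_top_of_tsum_ne_top hm_top), ← ENNReal.coe_toReal,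
      ← ENNReal.toReal_add hm_top ENNReal.coe_ne_top, ← ENNReal.toReal_one]
    exact ENNReal.toReal_mono (by simp [hm_top]) hm
  have abs_sub_le a : |(μ a).toReal - (ν a).toReal| ≤
      (μ a).toReal + (ν a).toReal - 2 * (m a).toReal := by
    have h₁ := ENNReal.toReal_mono (μ.apply_ne_top a) (hμ a)
    have h₂ := ENNReal.toReal_mono (ν.apply_ne_top a) (hν a)
    rw [abs_le]
    constructor <;> linarith
  have sum_add := (summable_toReal μ).add (summable_toReal ν)
  have sum_m := (ENNReal.summable_toReal hm_top).mul_left 2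
  have tsum_le : ∑' a, |(μ a).toReal - (ν a).toReal| ≤ 2 - 2 * ∑' a, (m a).toReal := by
    refine (((summable_toReal μ).sub (summable_toReal ν)).abs.tsum_le_tsum abs_sub_le
      (sum_add.sub sum_m)).trans_eq ?_
    rw [sum_add.tsum_sub sum_m, (summable_toReal μ).tsum_add (summable_toReal ν), tsum_mul_left,
      tsum_toReal, tsum_toReal, one_add_one_eq_two]
  rw [tvDist]
  linarith

lemma tvDist_bind_le {μ : PMF α} {p : PMF Ω} {k : Ω → PMF α} {X : Ω → ℝ≥0∞} {d : ℝ≥0}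
    (hμ : ∀ a, μ a = expect p fun ω => X ω * k ω a)
    (hX : 1 ≤ expect p (fun ω => min (X ω) 1) + d) : tvDist μ (p.bind k) ≤ d := by
  refine tvDist_le_of_minorant (m := fun a => expect p fun ω => min (X ω) 1 * k ω a)
    (fun a => ?_) (fun a => ?_) ?_
  · rw [hμ]
    exact expect_mono p fun ω => by gcongr; exact min_le_left _ _
  · rw [PMF.bind_apply]
    exact expect_mono p fun ω => mul_le_of_le_one_left' (min_le_right _ _)
  · simpa only [← expect_tsum, ENNReal.tsum_mul_left, PMF.tsum_coe, mul_one] using hX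

lemma one_le_expect_min_add {p : PMF Ω} {X : Ω → ℝ≥0∞} {l : ℝ≥0} (hl : 0 < l)
    (hX : expect p X = 1) (hX2 : expect p (fun ω => X ω ^ 2) ≤ 1 + l ^ 2) :
    1 ≤ expect p (fun ω => min (X ω) 1) + (l / 2 : ℝ≥0) := by
  -- This is `0 ≤ (|x - 1| - l) ^ 2` with `|x - 1| = x + 1 - 2 * min x 1`.
  have pointwise (x : ℝ≥0∞) :
      2 * l * (x + 1) + 2 * x ≤ 4 * l * min x 1 + (x ^ 2 + (1 + l ^ 2)) := by
    obtain rfl | hx := eq_or_ne x ∞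
    · simp
    lift x to ℝ≥0 using hx
    norm_cast
    rw [← NNReal.coe_le_coe]
    push_cast
    rcases min_cases (x : ℝ) 1 with h | h <;> rw [h.1]
    · nlinarith [sq_nonneg (1 - (x : ℝ) - l)]
    · nlinarith [sq_nonneg ((x : ℝ) - 1 - l)]
  have integrated := expect_mono p fun ω => pointwise (X ω)
  simp only [expect_add, expect_mul_left, expect_const, hX] at integrated
  set I := expect p fun ω => min (X ω) 1
  have hI : 4 * l * 1 + 2 ≤ 4 * l * (I + (l / 2 : ℝ≥0)) + 2 := calc
    (4 * l * 1 + 2 : ℝ≥0∞) = 2 * l * (1 + 1) + 2 * 1 := by ring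
    _ ≤ 4 * l * I + ((1 + l ^ 2) + (1 + l ^ 2)) := by grw [integrated, hX2]
    _ = 4 * l * I + (4 * l * (l / 2) + 2 : ℝ≥0) := by
      congr 1
      norm_cast
      rw [← NNReal.coe_inj]
      push_cast
      ring
    _ = 4 * l * (I + (l / 2 : ℝ≥0)) + 2 := by push_cast; ring
  exact (ENNReal.mul_le_mul_iff_right (by simp [hl.ne']) (by finiteness)).1
    ((ENNReal.add_le_add_iff_right (by simp)).1 hI)

end TotalVariation

/-! ### Minorization and independent draws -/

/-- `p` has a component `q` of mass `θ`: a sampler for `p` can be coupled to return a sample of `q`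
with probability `θ`. -/
def Minorizes {α : Type*} (θ : ℝ≥0∞) (q p : PMF α) : Prop := ∀ a, θ * q a ≤ p a

namespace Minorizes
variable {α β : Type*} {θ η : ℝ≥0∞} {p q : PMF α}

lemma refl (p : PMF α) : Minorizes 1 p p := fun a => (one_mul (p a)).le

lemma mono (h : Minorizes θ q p) (hη : η ≤ θ) : Minorizes η q p :=
  fun a => (by gcongr : η * q a ≤ θ * q a).trans (h a)

lemma bind (h : Minorizes θ q p) {l k : α → PMF β} (hk : ∀ a, Minorizes η (l a) (k a)) :
    Minorizes (θ * η) (q.bind l) (p.bind k) := fun b => by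
  simp only [PMF.bind_apply, ← ENNReal.tsum_mul_left]
  refine ENNReal.tsum_le_tsum fun a => ?_
  rw [mul_mul_mul_comm]
  gcongr
  exacts [h a, hk a b]

lemma bind_right (h : Minorizes θ q p) (k : α → PMF β) :
    Minorizes θ (q.bind k) (p.bind k) := by
  simpa using h.bind fun a => refl (k a)

lemma map (h : Minorizes θ q p) (f : α → β) : Minorizes θ (q.map f) (p.map f) :=
  h.bind_right _

lemma bind_of_mem {A : Set α} {r : PMF β} {k : α → PMF β} (h : ∀ a ∈ A, Minorizes θ r (k a)) :
    Minorizes (p.toOuterMeasure A * θ) r (p.bind k) := fun b => by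
  rw [PMF.toOuterMeasure_apply, PMF.bind_apply, mul_assoc, ← ENNReal.tsum_mul_right]
  refine ENNReal.tsum_le_tsum fun a => ?_
  by_cases ha : a ∈ A
  · rw [Set.indicator_of_mem ha]
    gcongr
    exact h a ha b
  · simp [ha]

lemma tvDist_le (h : Minorizes θ q p) {d : ℝ≥0} (hd : 1 ≤ θ + d) : tvDist q p ≤ d := by
  have hθ : θ ≤ 1 := by
    simpa only [ENNReal.tsum_mul_left, PMF.tsum_coe, mul_one] using ENNReal.tsum_le_tsum h
  refine tvDist_le_of_minorant (fun a => mul_le_of_le_one_left' hθ) h ?_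
  rwa [ENNReal.tsum_mul_left, PMF.tsum_coe, mul_one]

end Minorizes

section Indep
variable {α β : Type*} {n : ℕ}

lemma Minorizes.indep {θ : ℝ≥0∞} {p q : Fin n → PMF α} (h : ∀ i, Minorizes θ (q i) (p i)) :
    Minorizes (θ ^ n) (indep n q) (indep n p) := by
  induction n with
  | zero => exact pow_zero θ ▸ refl _
  | succ n ih =>
    rw [pow_succ']
    exact (h 0).bind fun x => (ih fun i => h i.succ).map _

lemma indep_map (p : Fin n → PMF α) (f : α → β) :
    (indep n p).map (fun x i => f (x i)) = indep n fun i => (p i).map f := by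
  induction n with
  | zero => exact (PMF.pure_map _ _).trans (congrArg PMF.pure (Subsingleton.elim _ _))
  | succ n ih =>
    simp only [indep, PMF.map_bind, PMF.map_comp, PMF.bind_map, ← ih]
    refine congrArg (p 0).bind (funext fun a => congrArg (PMF.map · _) (funext₂ fun x i => ?_))
    cases i using Fin.cases <;> rfl

lemma expect_indep_succ (p : Fin (n + 1) → PMF α) (f : (Fin (n + 1) → α) → ℝ≥0∞) :
    expect (indep (n + 1) p) f =
      expect (p 0) fun x => expect (indep n fun i => p i.succ) fun xs => f (Fin.cons x xs) := by
  simp only [indep, expect_bind, expect_map]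

lemma expect_indep_prod (p : Fin n → PMF α) (f : Fin n → α → ℝ≥0∞) :
    expect (indep n p) (fun x => ∏ i, f i (x i)) = ∏ i, expect (p i) (f i) := by
  induction n with
  | zero => simp [indep, expect_pure]
  | succ n ih =>
    simp only [expect_indep_succ, Fin.prod_univ_succ, Fin.cons_zero, Fin.cons_succ,
      expect_mul_left, expect_mul_right, ih (fun i => p i.succ) fun i => f i.succ]

lemma expect_indep_apply (p : Fin n → PMF α) (f : α → ℝ≥0∞) (i : Fin n) :
    expect (indep n p) (fun x => f (x i)) = expect (p i) f := by
  have h := expect_indep_prod p fun j a => if j = i then f a else 1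
  rw [Finset.prod_eq_single i (fun j _ hj => by simp [hj, expect_const]) (by simp)] at h
  simpa using h

lemma expect_indep_sum (p : Fin n → PMF α) (f : Fin n → α → ℝ≥0∞) :
    expect (indep n p) (fun x => ∑ i, f i (x i)) = ∑ i, expect (p i) (f i) := by
  simp only [expect_sum, expect_indep_apply]

lemma expect_indep_sum_sq_le (p : Fin n → PMF α) (f : Fin n → α → ℝ≥0∞) :
    expect (indep n p) (fun x => (∑ i, f i (x i)) ^ 2) ≤
      ∑ i, expect (p i) (fun a => f i a ^ 2) + (∑ i, expect (p i) (f i)) ^ 2 := by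
  induction n with
  | zero => simp [indep, expect_pure]
  | succ n ih =>
    have add_sq' (a b : ℝ≥0∞) : (a + b) ^ 2 = a ^ 2 + 2 * a * b + b ^ 2 := by ring
    simp only [expect_indep_succ, Fin.sum_univ_succ, Fin.cons_zero, Fin.cons_succ, add_sq',
      expect_add, expect_const, expect_mul_left, expect_mul_right,
      expect_indep_sum (fun i => p i.succ) fun i => f i.succ]
    grw [ih (fun i => p i.succ) fun i => f i.succ]
    exact le_self_add.trans_eq (b := _ + expect (p 0) (f 0) ^ 2) (by ring)

lemma expect_indep_sum_sq_le_mul {p : Fin n → PMF α} {f : Fin n → α → ℝ≥0∞} {b c : ℝ≥0∞}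
    (hf : ∀ i, 1 ≤ b * expect (p i) (f i)) (hf2 : ∀ i, expect (p i) (fun a => f i a ^ 2) ≤ c) :
    expect (indep n p) (fun x => (∑ i, f i (x i)) ^ 2) ≤
      (1 + c * b ^ 2 / n) * (∑ i, expect (p i) (f i)) ^ 2 := by
  have hsum : (n : ℝ≥0∞) ≤ b * ∑ i, expect (p i) (f i) := by
    simpa [Finset.mul_sum] using Finset.sum_le_sum fun i (_ : i ∈ Finset.univ) => hf i
  set s := ∑ i, expect (p i) (f i)
  have variance_le : ∑ i, expect (p i) (fun a => f i a ^ 2) ≤ c * b ^ 2 / n * s ^ 2 := by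
    obtain rfl | hn := eq_or_ne n 0
    · simp
    calc ∑ i, expect (p i) (fun a => f i a ^ 2)
      _ ≤ ∑ _ : Fin n, c := Finset.sum_le_sum fun i _ => hf2 i
      _ = c / n * n ^ 2 := by
        rw [Finset.sum_const, Finset.card_univ, Fintype.card_fin, nsmul_eq_mul, sq, ← mul_assoc,
          ENNReal.div_mul_cancel (by simp [hn]) (by simp), mul_comm]
      _ ≤ c / n * (b * s) ^ 2 := by gcongr
      _ = c * b ^ 2 / n * s ^ 2 := by simp only [div_eq_mul_inv]; ring
  grw [expect_indep_sum_sq_le, variance_le]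
  exact le_of_eq (by ring)

lemma expect_indep_mean_sq_le_mul {p : Fin n → PMF α} {f : Fin n → α → ℝ≥0∞} {b c : ℝ≥0∞}
    (hf : ∀ i, 1 ≤ b * expect (p i) (f i)) (hf2 : ∀ i, expect (p i) (fun a => f i a ^ 2) ≤ c) :
    expect (indep n p) (fun x => ((∑ i, f i (x i)) / n) ^ 2) ≤
      (1 + c * b ^ 2 / n) * ((∑ i, expect (p i) (f i)) / n) ^ 2 := by
  simp only [div_eq_mul_inv _ (n : ℝ≥0∞), mul_pow, expect_mul_right]
  grw [expect_indep_sum_sq_le_mul hf hf2]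
  exact le_of_eq (by simp only [div_eq_mul_inv]; ring)

lemma expect_indep_mean [NeZero n] (p : PMF α) (f : α → ℝ≥0∞) :
    expect (indep n fun _ => p) (fun x => (∑ i, f (x i)) / n) = expect p f := by
  simp only [div_eq_mul_inv, expect_mul_right, expect_indep_sum, Finset.sum_const,
    Finset.card_univ, Fintype.card_fin, nsmul_eq_mul]
  rw [mul_right_comm, ENNReal.mul_inv_cancel (by simp [NeZero.ne n]) (by simp), one_mul]

lemma expect_indep_mean_sq_le [NeZero n] (p : PMF α) (f : α → ℝ≥0∞) :
    expect (indep n fun _ => p) (fun x => ((∑ i, f (x i)) / n) ^ 2) ≤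
      expect p (fun a => f a ^ 2) / n + expect p f ^ 2 := by
  have hn : (n : ℝ≥0∞) * (n : ℝ≥0∞)⁻¹ = 1 :=
    ENNReal.mul_inv_cancel (by simp [NeZero.ne n]) (by simp)
  simp only [div_eq_mul_inv, mul_pow, expect_mul_right]
  grw [expect_indep_sum_sq_le (fun _ => p) fun _ => f]
  simp only [Finset.sum_const, Finset.card_univ, Fintype.card_fin, nsmul_eq_mul]
  refine le_of_eq ?_
  calc _ = expect p (fun a => f a ^ 2) * (n : ℝ≥0∞)⁻¹ * (n * (n : ℝ≥0∞)⁻¹)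
        + expect p f ^ 2 * (n * (n : ℝ≥0∞)⁻¹) ^ 2 := by ring
    _ = _ := by rw [hn]; ring

end Indep

/-! ### Chernoff bounds -/

section Tilt
variable {α : Type*} {μ : PMF α} {g : α → ℝ} {Z : ℝ}

lemma normalizeOr_apply_mul_tsum (μ : PMF α) {w : α → ℝ≥0∞} (h0 : ∑' a, w a ≠ 0)
    (h1 : ∑' a, w a ≠ ∞) (a : α) : normalizeOr μ w a * ∑' b, w b = w a := by
  rw [normalizeOr, dif_pos ⟨h0, h1⟩, PMF.normalize_apply, ← div_eq_mul_inv,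
    ENNReal.div_mul_cancel h0 h1]

lemma tilt_apply_mul (hZ : expect μ (fun a => ENNReal.ofReal (g a)) = ENNReal.ofReal Z)
    (hZ0 : 0 < Z) (a : α) : tilt μ g a * ENNReal.ofReal Z = μ a * ENNReal.ofReal (g a) := by
  have h0 : expect μ (fun a => ENNReal.ofReal (g a)) ≠ 0 := by simpa [hZ] using hZ0
  have h1 : expect μ (fun a => ENNReal.ofReal (g a)) ≠ ∞ := by simp [hZ]
  rw [← hZ]
  exact normalizeOr_apply_mul_tsum μ h0 h1 a

end Tilt

section Chernoff
variable {α : Type*} {μ : PMF α} {X : α → ℝ} {m : ℝ}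

lemma expect_exp_le (hX : ∀ a, X a ∈ Set.Icc 0 1) (hm0 : 0 ≤ m)
    (hm : expect μ (fun a => ENNReal.ofReal (X a)) = ENNReal.ofReal m) :
    expect μ (fun a => ENNReal.ofReal (Real.exp (X a))) ≤ ENNReal.ofReal (Real.exp (2 * m)) := by
  have exp_le_affine a : Real.exp (X a) ≤ 1 + 2 * X a := by
    have := abs_le.1 (Real.abs_exp_sub_one_sub_id_le ((abs_of_nonneg (hX a).1).trans_le (hX a).2))
    nlinarith [(hX a).1, (hX a).2]
  calc expect μ (fun a => ENNReal.ofReal (Real.exp (X a)))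
    _ ≤ expect μ (fun a => 1 + 2 * ENNReal.ofReal (X a)) := expect_mono μ fun a => by
      grw [exp_le_affine a, ENNReal.ofReal_add zero_le_one (by linarith [(hX a).1])]
      simp [ENNReal.ofReal_mul]
    _ = ENNReal.ofReal (1 + 2 * m) := by
      rw [expect_add, expect_const, expect_mul_left, hm,
        ENNReal.ofReal_add zero_le_one (by linarith)]
      simp [ENNReal.ofReal_mul]
    _ ≤ ENNReal.ofReal (Real.exp (2 * m)) :=
      ENNReal.ofReal_le_ofReal (by linarith [Real.add_one_le_exp (2 * m)])

lemma expect_exp_neg_le (hX : ∀ a, X a ∈ Set.Icc 0 1) (hm0 : 0 ≤ m)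
    (hm : expect μ (fun a => ENNReal.ofReal (X a)) = ENNReal.ofReal m) :
    expect μ (fun a => ENNReal.ofReal (Real.exp (-X a))) ≤
      ENNReal.ofReal (Real.exp (-(m / 2))) := by
  have exp_neg_le_affine a : Real.exp (-X a) + X a / 2 ≤ 1 := by
    have hmul : Real.exp (-X a) * Real.exp (X a) = 1 := by rw [← Real.exp_add]; simp
    nlinarith [Real.exp_pos (-X a), Real.add_one_le_exp (X a), (hX a).1, (hX a).2]
  have half (x : ℝ) : ENNReal.ofReal (x / 2) = ENNReal.ofReal x * 2⁻¹ := by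
    rw [ENNReal.ofReal_div_of_pos two_pos, ENNReal.ofReal_ofNat, div_eq_mul_inv]
  have add_le_one :
      expect μ (fun a => ENNReal.ofReal (Real.exp (-X a))) + ENNReal.ofReal (m / 2) ≤ 1 := by
    rw [half, ← hm, ← expect_mul_right, ← expect_add]
    refine expect_le μ fun a => ?_
    rw [← half, ← ENNReal.ofReal_add (Real.exp_pos _).le (by linarith [(hX a).1])]
    exact ENNReal.ofReal_le_one.2 (exp_neg_le_affine a)
  calc expect μ (fun a => ENNReal.ofReal (Real.exp (-X a)))
    _ ≤ 1 - ENNReal.ofReal (m / 2) :=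
      ENNReal.le_sub_of_add_le_right ENNReal.ofReal_ne_top add_le_one
    _ = ENNReal.ofReal (1 - m / 2) := by
      rw [ENNReal.ofReal_sub _ (by linarith), ENNReal.ofReal_one]
    _ ≤ ENNReal.ofReal (Real.exp (-(m / 2))) :=
      ENNReal.ofReal_le_ofReal (Real.one_sub_le_exp_neg _)

lemma toOuterMeasure_le_sum_le {f : α → ℝ} {r : ℝ} (n : ℕ) (u : ℝ)
    (h : expect μ (fun a => ENNReal.ofReal (Real.exp (f a))) ≤ ENNReal.ofReal (Real.exp r)) :
    (indep n fun _ => μ).toOuterMeasure {x | u ≤ ∑ i, f (x i)} ≤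
      ENNReal.ofReal (Real.exp (n * r - u)) := by
  have exp_sum_sub (x : Fin n → α) : ENNReal.ofReal (Real.exp (∑ i, f (x i) - u)) =
      (∏ i, ENNReal.ofReal (Real.exp (f (x i)))) * ENNReal.ofReal (Real.exp (-u)) := by
    rw [← ENNReal.ofReal_prod_of_nonneg fun i _ => (Real.exp_pos _).le, ← Real.exp_sum,
      ← ENNReal.ofReal_mul (Real.exp_pos _).le, ← Real.exp_add, sub_eq_add_neg]
  calc (indep n fun _ => μ).toOuterMeasure {x | u ≤ ∑ i, f (x i)}
    _ ≤ expect (indep n fun _ => μ) fun x => ENNReal.ofReal (Real.exp (∑ i, f (x i) - u)) :=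
      toOuterMeasure_le_expect _ fun x hx =>
        ENNReal.one_le_ofReal.2 (Real.one_le_exp (sub_nonneg.2 hx))
    _ = expect μ (fun a => ENNReal.ofReal (Real.exp (f a))) ^ n
        * ENNReal.ofReal (Real.exp (-u)) := by
      simp only [exp_sum_sub, expect_mul_right, expect_indep_prod (fun _ => μ)
        fun _ a => ENNReal.ofReal (Real.exp (f a)), Finset.prod_const, Finset.card_univ,
        Fintype.card_fin]
    _ ≤ ENNReal.ofReal (Real.exp r) ^ n * ENNReal.ofReal (Real.exp (-u)) := by gcongr
    _ = ENNReal.ofReal (Real.exp (n * r - u)) := by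
      rw [← ENNReal.ofReal_pow (Real.exp_pos _).le, ← Real.exp_nat_mul,
        ← ENNReal.ofReal_mul (by positivity), ← Real.exp_add, sub_eq_add_neg]

lemma one_le_toOuterMeasure_sum_add (hX : ∀ a, X a ∈ Set.Icc 0 1) (hm0 : 0 ≤ m)
    (hm : expect μ (fun a => ENNReal.ofReal (X a)) = ENNReal.ofReal m) (n : ℕ) :
    1 ≤ (indep n fun _ => μ).toOuterMeasure
        {x | n * m / 4 ≤ ∑ i, X (x i) ∧ ∑ i, X (x i) ≤ 4 * (n * m)} +
      2 * ENNReal.ofReal (Real.exp (-(n * m / 4))) := by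
  set P := (indep n fun _ => μ).toOuterMeasure
  have hnm : 0 ≤ n * m := by positivity
  have upper : P {x | 4 * (n * m) ≤ ∑ i, X (x i)} ≤
      ENNReal.ofReal (Real.exp (-(n * m / 4))) := by
    grw [toOuterMeasure_le_sum_le n _ (expect_exp_le hX hm0 hm)]
    exact ENNReal.ofReal_le_ofReal (Real.exp_le_exp.2 (by linarith))
  have lower : P {x | -(n * m / 4) ≤ ∑ i, -X (x i)} ≤
      ENNReal.ofReal (Real.exp (-(n * m / 4))) := by
    grw [toOuterMeasure_le_sum_le n _ (expect_exp_neg_le hX hm0 hm)]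
    exact ENNReal.ofReal_le_ofReal (Real.exp_le_exp.2 (by linarith))
  rw [two_mul]
  refine le_trans ?_ (add_le_add_right (add_le_add upper lower) _)
  grw [← MeasureTheory.measure_union_le, ← MeasureTheory.measure_union_le]
  refine ((PMF.toOuterMeasure_apply_eq_one_iff _ _).2 fun x _ => ?_).ge
  simp only [Finset.sum_neg_distrib, neg_le_neg_iff, Set.mem_union, Set.mem_ofPred_eq]
  grind

lemma one_le_toOuterMeasure_mean_add {g : α → ℝ} {Z B : ℝ} {n : ℕ} (hg : ∀ a, 0 ≤ g a)
    (hZ : expect μ (fun a => ENNReal.ofReal (g a)) = ENNReal.ofReal Z) (hZ0 : 0 < Z) (hB : 0 < B)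
    (hgB : ∀ a, g a ≤ B * Z) (hn : 0 < n) :
    1 ≤ (indep n fun _ => μ).toOuterMeasure
        {x | Z / 4 ≤ (∑ i, g (x i)) / n ∧ (∑ i, g (x i)) / n ≤ 4 * Z} +
      2 * ENNReal.ofReal (Real.exp (-(n / (4 * B)))) := by
  have hBZ : 0 < B * Z := mul_pos hB hZ0
  have hn' : (0 : ℝ) < n := by exact_mod_cast hn
  have mean_scaled : expect μ (fun a => ENNReal.ofReal (g a / (B * Z))) = ENNReal.ofReal B⁻¹ := by
    simp only [ENNReal.ofReal_div_of_pos hBZ, div_eq_mul_inv _ (ENNReal.ofReal _),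
      expect_mul_right, hZ]
    rw [← div_eq_mul_inv, ← ENNReal.ofReal_div_of_pos hBZ]
    congr 1
    field_simp
  refine (one_le_toOuterMeasure_sum_add
    (fun a => ⟨div_nonneg (hg a) hBZ.le, (div_le_one hBZ).2 (hgB a)⟩)
    (inv_nonneg.2 hB.le) mean_scaled n).trans_eq ?_
  congr! 5
  · rw [← Finset.sum_div, le_div_iff₀ hBZ, le_div_iff₀ hn',
      show n * B⁻¹ / 4 * (B * Z) = Z / 4 * n by field_simp]
  · rw [← Finset.sum_div, div_le_iff₀ hBZ, div_le_iff₀ hn',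
      show 4 * (n * B⁻¹) * (B * Z) = 4 * Z * n by field_simp]
  · field_simp

end Chernoff

/-! ### Rejection sampling -/

section Rejection
variable {α : Type*} {n : ℕ}

lemma RSRun.out_cons (zs : Fin (n + 1) → α) (zs' : Fin n → α) (p : α × Bool)
    (tr : Fin n → α × Bool) (z : α) :
    (⟨zs, Fin.cons p tr, z⟩ : RSRun α (n + 1)).out =
      if p.2 then p.1 else (⟨zs', tr, z⟩ : RSRun α n).out := by
  obtain ⟨a, _ | _⟩ := p
  · have cons_succ : (fun i : Fin (n + 1) =>
        (Fin.cons (a, false) tr : Fin (n + 1) → α × Bool) i |>.2) ∘ Fin.succ =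
        fun i => (tr i).2 := rfl
    simp only [out, firstAccept, List.finRange_succ, List.find?_cons, Fin.cons_zero,
      List.find?_map, cons_succ, Bool.false_eq_true, if_false]
    cases List.find? (fun i => (tr i).2) (List.finRange n) <;> simp
  · simp [out, firstAccept, List.finRange_succ]

lemma RSRun.time_le (r : RSRun α n) : r.time ≤ 5 * n + 1 := by
  unfold RSRun.time
  cases r.firstAccept <;> grind

lemma map_out_trials_succ (ν : PMF (α × Bool)) (zs : Fin (n + 1) → α) (z : α) :
    (indep (n + 1) fun _ => ν).map (fun tr => RSRun.out ⟨zs, tr, z⟩) =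
      ν.bind fun p => if p.2 then PMF.pure p.1 else
        (indep n fun _ => ν).map fun tr => RSRun.out ⟨fun i => zs i.succ, tr, z⟩ := by
  simp only [indep, PMF.map_bind, PMF.map_comp, Function.comp_def,
    RSRun.out_cons zs fun i => zs i.succ]
  refine congrArg _ (funext fun ⟨a, b⟩ => ?_)
  cases b
  · rfl
  · exact PMF.map_const _ _

lemma minorizes_firstAccept {ν : PMF (α × Bool)} {q : PMF α} {a : ℝ≥0∞}
    (hν : ∀ z, ν (z, true) = a * q z) (zs : Fin n → α) (z : α) :
    Minorizes (1 - (1 - a) ^ n) q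
      ((indep n fun _ => ν).map fun tr => RSRun.out ⟨zs, tr, z⟩) := by
  have mass : a + ∑' z, ν (z, false) = 1 := by
    rw [← ν.tsum_coe, ENNReal.tsum_prod']
    simp only [tsum_bool, ENNReal.tsum_add, hν, ENNReal.tsum_mul_left, PMF.tsum_coe, mul_one,
      add_comm]
  have hb : ∑' z, ν (z, false) = 1 - a :=
    ENNReal.eq_sub_of_add_eq' ENNReal.one_ne_top (by rwa [add_comm])
  rw [hb] at mass
  induction n with
  | zero => simp [Minorizes]
  | succ n ih =>
    intro c
    classical
    rw [map_out_trials_succ, PMF.bind_apply, ENNReal.tsum_prod']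
    simp only [tsum_bool, Bool.false_eq_true, if_true, if_false, PMF.pure_apply, hν,
      ENNReal.tsum_add, ENNReal.tsum_mul_right, hb, mul_ite, mul_one, mul_zero, @eq_comm _ c,
      tsum_ite_eq]
    grw [← ih (fun i => zs i.succ) c]
    rw [← mul_assoc, ← add_mul]
    gcongr
    rw [tsub_le_iff_right]
    calc 1 = (1 - a) * 1 + a := by rw [mul_one, add_comm, mass]
      _ ≤ (1 - a) * (1 - (1 - a) ^ n + (1 - a) ^ n) + a := by gcongr; exact le_tsub_add
      _ = _ := by ring

lemma coin_true {p : ℝ} (h : p ≤ 1) : coin p true = ENNReal.ofReal p := by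
  change ((min p.toNNReal 1 : ℝ≥0) : ℝ≥0∞) = p.toNNReal
  rw [min_eq_left (Real.toNNReal_le_one.2 h)]

/-- One trial of rejection sampling: a draw `z ∼ μ` and a coin that accepts it with
probability `r z`. -/
noncomputable def trialLaw (μ : PMF α) (r : α → ℝ) : PMF (α × Bool) :=
  μ.bind fun z => (coin (r z)).map fun b => (z, b)

lemma trialLaw_true (μ : PMF α) {r : α → ℝ} {z : α} (hr : r z ≤ 1) :
    trialLaw μ r (z, true) = μ z * ENNReal.ofReal (r z) := by
  classical
  have accept (y : α) : ((coin (r y)).map fun b => (y, b)) (z, true) =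
      if y = z then coin (r y) true else 0 := by
    obtain rfl | h := eq_or_ne y z
    · simp [PMF.map_apply]
    · simp [PMF.map_apply, h, h.symm]
  simp only [trialLaw, PMF.bind_apply, accept, mul_ite, mul_zero, tsum_ite_eq, coin_true hr]

variable {μ : PMF α} {g : α → ℝ} {Z B δ : ℝ}

lemma le_rsBudget (M δ : ℝ) : 4 * M * Real.log (4 / δ) ≤ rsBudget M δ := Nat.le_ceil _

lemma minorizes_trials_of_mean_mem {W : ℝ}
    (hZ : expect μ (fun a => ENNReal.ofReal (g a)) = ENNReal.ofReal Z) (hZ0 : 0 < Z) (hB : 0 < B)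
    (hgB : ∀ a, g a ≤ B * Z) (hδ : 0 < δ) (hW : Z / 4 ≤ W) (hW' : W ≤ 4 * Z)
    (hn : 16 * B * Real.log (4 / δ) ≤ n) (zs : Fin n → α) (z : α) :
    Minorizes (1 - ENNReal.ofReal (δ / 4)) (tilt μ g)
      ((indep n fun _ => trialLaw μ fun z => g z / (4 * B * W)).map
        fun tr => RSRun.out ⟨zs, tr, z⟩) := by
  have hW0 : 0 < W := by linarith
  have ratio_le_one a : g a / (4 * B * W) ≤ 1 := by
    rw [div_le_one (by positivity)]
    nlinarith [hgB a]
  have accept_prob a : trialLaw μ (fun z => g z / (4 * B * W)) (a, true) =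
      ENNReal.ofReal (Z / (4 * B * W)) * tilt μ g a := by
    rw [trialLaw_true μ (ratio_le_one a), ENNReal.ofReal_div_of_pos (by positivity),
      ENNReal.ofReal_div_of_pos (by positivity), ← mul_div_assoc, ← tilt_apply_mul hZ hZ0,
      mul_div_assoc, mul_comm]
  have accept_ge : 1 / (16 * B) ≤ Z / (4 * B * W) := by
    rw [div_le_div_iff₀ (by positivity) (by positivity)]
    nlinarith
  refine (minorizes_firstAccept accept_prob zs z).mono (tsub_le_tsub_left ?_ 1)
  calc (1 - ENNReal.ofReal (Z / (4 * B * W))) ^ n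
    _ ≤ ENNReal.ofReal (Real.exp (-(1 / (16 * B)))) ^ n := by
      gcongr
      rw [← ENNReal.ofReal_one, ← ENNReal.ofReal_sub _ (by positivity)]
      exact ENNReal.ofReal_le_ofReal
        ((sub_le_sub_left accept_ge 1).trans (Real.one_sub_le_exp_neg _))
    _ = ENNReal.ofReal (Real.exp (-(n / (16 * B)))) := by
      rw [← ENNReal.ofReal_pow (Real.exp_pos _).le, ← Real.exp_nat_mul]
      ring_nf
    _ ≤ ENNReal.ofReal (Real.exp (-Real.log (4 / δ))) := by
      gcongr
      rwa [le_div_iff₀ (by positivity), mul_comm]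
    _ = ENNReal.ofReal (δ / 4) := by rw [Real.exp_neg, Real.exp_log (by positivity), inv_div]

lemma map_out_rejectionSampling (g : α → ℝ) (μ : PMF α) (M : ℝ) (n : ℕ) :
    (rejectionSampling g μ M n).map RSRun.out =
      (indep n fun _ => μ).bind fun zs => μ.bind fun z =>
        (indep n fun _ => trialLaw μ fun z => g z / (M * ((∑ i, g (zs i)) / n))).map
          fun tr => RSRun.out ⟨zs, tr, z⟩ := by
  simp only [rejectionSampling, PMF.map_bind, PMF.map_comp]
  refine congrArg _ (funext fun zs => ?_)
  exact PMF.bind_comm _ _ _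

theorem minorizes_rejectionSampling (hg : ∀ a, 0 ≤ g a)
    (hZ : expect μ (fun a => ENNReal.ofReal (g a)) = ENNReal.ofReal Z) (hZ0 : 0 < Z) (hB : 0 < B)
    (hgB : ∀ a, g a ≤ B * Z) (hδ : 0 < δ) (hδ1 : δ ≤ 1) :
    Minorizes (1 - ENNReal.ofReal δ) (tilt μ g)
      ((rejectionSampling g μ (4 * B) (rsBudget (4 * B) δ)).map RSRun.out) := by
  have hn := le_rsBudget (4 * B) δ
  set n := rsBudget (4 * B) δ
  have hlog : 0 < Real.log (4 / δ) := Real.log_pos (by rw [lt_div_iff₀ hδ]; linarith)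
  have hn0 : 0 < n := Nat.cast_pos.1 (lt_of_lt_of_le (by positivity) hn)
  set good : Set (Fin n → α) := {zs | Z / 4 ≤ (∑ i, g (zs i)) / n ∧ (∑ i, g (zs i)) / n ≤ 4 * Z}
  set x := ENNReal.ofReal (δ / 4)
  have good_prob : 1 ≤ (indep n fun _ => μ).toOuterMeasure good + 2 * x := by
    refine (one_le_toOuterMeasure_mean_add hg hZ hZ0 hB hgB hn0).trans ?_
    gcongr
    simp only [x]
    rw [← inv_div 4 δ, ← Real.exp_log (show 0 < 4 / δ by positivity), ← Real.exp_neg]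
    gcongr
    rw [le_div_iff₀ (by positivity)]
    nlinarith [mul_pos hB hlog]
  rw [map_out_rejectionSampling]
  refine (Minorizes.bind_of_mem (θ := 1 - x) (A := good) fun zs hzs => ?_).mono ?_
  · simpa only [PMF.bind_const, one_mul] using (Minorizes.refl μ).bind fun z =>
      minorizes_trials_of_mean_mem hZ hZ0 hB hgB hδ hzs.1 hzs.2 (by linarith) zs z
  · have hx : ENNReal.ofReal δ = x + x + 2 * x := by
      simp only [x, two_mul, ← ENNReal.ofReal_add, show 0 ≤ δ / 4 by positivity, add_nonneg]
      ring_nf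
    set P := (indep n fun _ => μ).toOuterMeasure good
    have hP : P ≤ 1 :=
      (toOuterMeasure_le_expect _ fun _ _ => le_rfl).trans_eq (expect_const _ 1)
    rw [tsub_le_iff_right, hx]
    calc 1 ≤ P * 1 + 2 * x := by rwa [mul_one]
      _ ≤ P * (1 - x + x) + 2 * x := by gcongr; exact le_tsub_add
      _ ≤ P * (1 - x) + 1 * x + 2 * x := by rw [mul_add]; gcongr
      _ ≤ P * (1 - x) + (x + x + 2 * x) := by
        rw [one_mul, add_assoc]; gcongr; exact le_self_add

end Rejection

/-! ### The Feynman–Kac model -/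

lemma expect_tilt_mul {α : Type*} {μ : PMF α} {g : α → ℝ} {Z : ℝ}
    (hZ : expect μ (fun a => ENNReal.ofReal (g a)) = ENNReal.ofReal Z) (hZ0 : 0 < Z)
    (f : α → ℝ≥0∞) :
    expect (tilt μ g) f * ENNReal.ofReal Z = expect μ fun a => ENNReal.ofReal (g a) * f a := by
  rw [expect, ← ENNReal.tsum_mul_right]
  refine tsum_congr fun a => ?_
  rw [mul_right_comm, tilt_apply_mul hZ hZ0, mul_assoc]

section Empirical
variable {α β : Type*} {N : ℕ} [NeZero N]

/-- The empirical law of the particles `x 0, …, x (N-1)`. -/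
noncomputable def empirical (x : Fin N → α) : PMF α := (PMF.uniformOfFintype (Fin N)).map x

lemma expect_empirical (x : Fin N → α) (f : α → ℝ≥0∞) :
    expect (empirical x) f = (∑ i, f (x i)) / N := by
  rw [empirical, expect_map, expect, tsum_fintype]
  simp only [PMF.uniformOfFintype_apply, Fintype.card_fin, ENNReal.div_eq_inv_mul, Finset.mul_sum]

end Empirical

/-- The extended nonnegative number `x` lies in `[1 / b, b]`. -/
def WithinFactor (b x : ℝ≥0∞) : Prop := x ≤ b ∧ 1 ≤ b * x

namespace WithinFactor
variable {α : Type*} {b c x y : ℝ≥0∞}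

lemma one : WithinFactor 1 1 := ⟨le_rfl, (one_mul 1).ge⟩

lemma mul (hx : WithinFactor b x) (hy : WithinFactor c y) : WithinFactor (b * c) (x * y) :=
  ⟨mul_le_mul' hx.1 hy.1, by rw [mul_mul_mul_comm]; exact one_le_mul hx.2 hy.2⟩

lemma mono (hx : WithinFactor b x) (h : b ≤ c) : WithinFactor c x :=
  ⟨hx.1.trans h, hx.2.trans (by gcongr)⟩

lemma expect (p : PMF α) {f : α → ℝ≥0∞} (hf : ∀ a ∈ p.support, WithinFactor b (f a)) :
    WithinFactor b (expect p f) := by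
  constructor
  · refine (ENNReal.tsum_le_tsum fun a => ?_).trans_eq (expect_const p b)
    by_cases ha : p a = 0
    · simp [ha]
    · gcongr
      exact (hf a ha).1
  · rw [← expect_mul_left]
    exact le_expect_of_support p fun a ha => (hf a ha).2

lemma one_le (hx : WithinFactor b x) : 1 ≤ b := by
  by_contra! hb
  exact ((mul_le_of_le_one_right' (hx.1.trans hb.le)).trans_lt hb).not_ge hx.2

lemma ne_zero (hx : WithinFactor b x) : x ≠ 0 := by
  rintro rfl
  simpa using hx.2

lemma ne_top (hx : WithinFactor b x) (hb : b ≠ ∞) : x ≠ ∞ := ne_top_of_le_ne_top hb hx.1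

end WithinFactor

namespace Model
variable {S : ℕ → Type u} (m : Model S) (s₀ : S 0)

/-- The optimal proposal: the next state with law `∝ π_ref(y | x) V(x, y)`. -/
noncomputable def optProposal (t : ℕ) (x : Pref S t) : PMF (S (t + 1)) :=
  tilt (m.ref s₀ t x) (m.nextV s₀ t x)

/-- The reward ratio `V(x, y) / V(x)` of one step. -/
noncomputable def ratio (t : ℕ) (x : Pref S t) (y : S (t + 1)) : ℝ≥0∞ :=
  ENNReal.ofReal (m.nextV s₀ t x y / m.V s₀ t x)

/-- The exact incremental weight `Z(x) / V(x)` of a prefix. -/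
noncomputable def weight (t : ℕ) (x : Pref S t) : ℝ≥0∞ := expect (m.ref s₀ t x) (m.ratio s₀ t x)

/-- The one-step Feynman–Kac operator `F ↦ E[V(x, y) F(x, y)] / V(x)`. -/
noncomputable def fkStep (t : ℕ) (F : Pref S (t + 1) → ℝ≥0∞) (x : Pref S t) : ℝ≥0∞ :=
  expect (m.ref s₀ t x) fun y => m.ratio s₀ t x y * F (x, y)

/-- The unnormalized target `F ↦ E[V F]`. -/
noncomputable def gamma (t : ℕ) (F : Pref S t → ℝ≥0∞) : ℝ≥0∞ :=
  expect (m.refLaw s₀ t) fun x => ENNReal.ofReal (m.V s₀ t x) * F x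

/-- The expected product of the next `r` reward ratios. -/
noncomputable def lookahead : (r t : ℕ) → Pref S t → ℝ≥0∞
  | 0, _ => fun _ => 1
  | r + 1, t => m.fkStep s₀ t (lookahead r (t + 1))

variable {m s₀} {T t : ℕ} {L ε : ℝ}

lemma fkStep_one (x : Pref S t) : m.fkStep s₀ t (fun _ => 1) x = m.weight s₀ t x := by
  simp only [fkStep, weight, mul_one]

lemma RatioBound.nextV_le (hR : m.RatioBound s₀ T L) (ht : t < T) (x : Pref S t) (y : S (t + 1)) :
    m.nextV s₀ t x y ≤ L * m.V s₀ t x :=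
  (div_le_iff₀ (hR.1 t ht.le x)).1 ((le_max_right _ _).trans (hR.2 t ht x y))

lemma RatioBound.nextV_pos (hR : m.RatioBound s₀ T L) (ht : t < T) (x : Pref S t)
    (y : S (t + 1)) : 0 < m.nextV s₀ t x y :=
  hR.1 (t + 1) ht (x, y)

lemma RatioBound.ratio_le (hR : m.RatioBound s₀ T L) (ht : t < T) (x : Pref S t) (y : S (t + 1)) :
    m.ratio s₀ t x y ≤ ENNReal.ofReal L :=
  ENNReal.ofReal_le_ofReal ((le_max_right _ _).trans (hR.2 t ht x y))

lemma RatioBound.expect_nextV (hR : m.RatioBound s₀ T L) (ht : t < T) (x : Pref S t) :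
    expect (m.ref s₀ t x) (fun y => ENNReal.ofReal (m.nextV s₀ t x y)) =
      ENNReal.ofReal (m.expNext s₀ t x) := by
  have hfin : expect (m.ref s₀ t x) (fun y => ENNReal.ofReal (m.nextV s₀ t x y)) ≠ ∞ :=
    ne_top_of_le_ne_top ENNReal.ofReal_ne_top <|
      expect_le _ fun y => ENNReal.ofReal_le_ofReal (hR.nextV_le ht x y)
  rw [← ENNReal.ofReal_toReal hfin, expect,
    ENNReal.tsum_toReal_eq (ENNReal.ne_top_of_tsum_ne_top hfin), expNext]
  simp only [ENNReal.toReal_mul, ENNReal.toReal_ofReal (hR.nextV_pos ht x _).le]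

lemma RatioBound.expNext_pos (hR : m.RatioBound s₀ T L) (ht : t < T) (x : Pref S t) :
    0 < m.expNext s₀ t x := by
  obtain ⟨y, hy⟩ := (m.ref s₀ t x).support_nonempty
  rw [← ENNReal.ofReal_pos, ← hR.expect_nextV ht x]
  refine lt_of_lt_of_le ?_ (ENNReal.le_tsum y)
  exact ENNReal.mul_pos hy (by simpa using hR.nextV_pos ht x y)

lemma RatioBound.pos (hR : m.RatioBound s₀ T L) (ht : t < T) (x : Pref S t) : 0 < L := by
  obtain ⟨y, -⟩ := (m.ref s₀ t x).support_nonempty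
  exact (div_pos (hR.nextV_pos ht x y) (hR.1 t ht.le x)).trans_le
    ((le_max_right _ _).trans (hR.2 t ht x y))

lemma BellmanBound.le_expNext (hB : m.BellmanBound s₀ T ε) (hR : m.RatioBound s₀ T L) (ht : t < T)
    (x : Pref S t) : m.V s₀ t x ≤ (1 + ε) * m.expNext s₀ t x :=
  (div_le_iff₀ (hR.expNext_pos ht x)).1 ((le_max_left _ _).trans (hB t ht x))

lemma RatioBound.fkStep_mul (hR : m.RatioBound s₀ T L) (ht : t < T) (x : Pref S t)
    (F : Pref S (t + 1) → ℝ≥0∞) :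
    m.fkStep s₀ t F x * ENNReal.ofReal (m.V s₀ t x) =
      expect (m.ref s₀ t x) fun y => ENNReal.ofReal (m.nextV s₀ t x y) * F (x, y) := by
  rw [fkStep, ← expect_mul_right]
  congr 1 with y
  have hV := hR.1 t ht.le x
  rw [mul_right_comm, ratio, ← ENNReal.ofReal_mul (div_pos (hR.nextV_pos ht x y) hV).le,
    div_mul_cancel₀ _ hV.ne']

lemma RatioBound.weight_mul (hR : m.RatioBound s₀ T L) (ht : t < T) (x : Pref S t) :
    m.weight s₀ t x * ENNReal.ofReal (m.V s₀ t x) = ENNReal.ofReal (m.expNext s₀ t x) := by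
  rw [← fkStep_one, hR.fkStep_mul ht, ← hR.expect_nextV ht x]
  simp only [mul_one]

lemma BellmanBound.withinFactor_weight (hB : m.BellmanBound s₀ T ε) (hR : m.RatioBound s₀ T L)
    (ht : t < T) (x : Pref S t) :
    WithinFactor (ENNReal.ofReal (Real.exp ε)) (m.weight s₀ t x) := by
  have hV := hR.1 t ht.le x
  have hZ := hR.expNext_pos ht x
  have hε : 1 + ε ≤ Real.exp ε := (add_comm 1 ε).trans_le (Real.add_one_le_exp ε)
  have weight_eq : m.weight s₀ t x = ENNReal.ofReal (m.expNext s₀ t x / m.V s₀ t x) := by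
    rw [ENNReal.ofReal_div_of_pos hV, ← hR.weight_mul ht x,
      ENNReal.mul_div_cancel_right (by simpa using hV) ENNReal.ofReal_ne_top]
  rw [weight_eq]
  constructor
  · exact ENNReal.ofReal_le_ofReal (((le_max_right _ _).trans (hB t ht x)).trans hε)
  · rw [← ENNReal.ofReal_mul (Real.exp_pos ε).le, ENNReal.one_le_ofReal, ← mul_div_assoc,
      le_div_iff₀ hV, one_mul]
    exact (hB.le_expNext hR ht x).trans (by gcongr)

lemma RatioBound.weight_mul_expect_optProposal (hR : m.RatioBound s₀ T L) (ht : t < T)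
    (x : Pref S t) (F : Pref S (t + 1) → ℝ≥0∞) :
    m.weight s₀ t x * expect (m.optProposal s₀ t x) (fun y => F (x, y)) = m.fkStep s₀ t F x := by
  rw [← ENNReal.mul_left_inj (c := ENNReal.ofReal (m.V s₀ t x))
    (by simpa using hR.1 t ht.le x) ENNReal.ofReal_ne_top, hR.fkStep_mul ht, mul_right_comm,
    hR.weight_mul ht, mul_comm]
  exact expect_tilt_mul (hR.expect_nextV ht x) (hR.expNext_pos ht x) _

lemma expect_refLaw_succ (f : Pref S (t + 1) → ℝ≥0∞) :
    expect (m.refLaw s₀ (t + 1)) f =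
      expect (m.refLaw s₀ t) fun x => expect (m.ref s₀ t x) fun y => f (x, y) :=
  (expect_bind _ _ _).trans (congrArg _ (funext fun x => expect_map _ (fun y => (x, y)) f))

lemma RatioBound.gamma_succ (hR : m.RatioBound s₀ T L) (ht : t < T)
    (F : Pref S (t + 1) → ℝ≥0∞) :
    m.gamma s₀ (t + 1) F = m.gamma s₀ t (m.fkStep s₀ t F) := by
  rw [gamma, expect_refLaw_succ, gamma]
  congr 1 with x
  rw [← mul_comm (m.fkStep s₀ t F x), hR.fkStep_mul ht]
  rfl

end Model

/-! ### Weighted particle systems -/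

lemma expect_ite_eq {α : Type*} [DecidableEq α] (p : PMF α) (a : α) :
    expect p (fun b => if b = a then 1 else 0) = p a := by
  simp [expect]

/-- Transition kernels of a weighted particle system: a step returns the new particles together
with the factor by which the weight of the system changes. -/
abbrev WeightedKernel (S : ℕ → Type u) (N : ℕ) : Type u :=
  (t : ℕ) → (Fin N → Pref S t) → PMF ((Fin N → Pref S (t + 1)) × ℝ≥0∞)

namespace WeightedKernel
variable {S : ℕ → Type u} {N : ℕ} (κ : WeightedKernel S N)

/-- The law of the particles and of the accumulated weight after `t` steps from empty prefixes. -/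
noncomputable def law : (t : ℕ) → PMF ((Fin N → Pref S t) × ℝ≥0∞)
  | 0 => PMF.pure (fun _ => PUnit.unit, 1)
  | t + 1 => (law t).bind fun p => (κ t p.1).map fun q => (q.1, p.2 * q.2)

variable {κ}

lemma expect_law_succ (t : ℕ) (f : (Fin N → Pref S (t + 1)) × ℝ≥0∞ → ℝ≥0∞) :
    expect (κ.law (t + 1)) f =
      expect (κ.law t) fun p => expect (κ t p.1) fun q => f (q.1, p.2 * q.2) := by
  simp only [law, expect_bind, expect_map]

lemma withinFactor_weight {T : ℕ} {b : ℝ≥0∞}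
    (hκ : ∀ t < T, ∀ x, ∀ q ∈ (κ t x).support, WithinFactor b q.2) {t : ℕ} (ht : t ≤ T) :
    ∀ p ∈ (κ.law t).support, WithinFactor (b ^ t) p.2 := by
  induction t with
  | zero =>
    intro p hp
    obtain rfl := (PMF.mem_support_pure_iff _ _).1 hp
    simpa using WithinFactor.one
  | succ t ih =>
    intro p hp
    obtain ⟨p', hp', hp⟩ := (PMF.mem_support_bind_iff _ _ _).1 hp
    obtain ⟨q, hq, rfl⟩ := (PMF.mem_support_map_iff _ _ _).1 hp
    rw [pow_succ]
    exact (ih (Nat.le_of_succ_le ht) p' hp').mul (hκ t ht _ q hq)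

variable [NeZero N]

lemma expect_law_zero (f : ℝ≥0∞ → ℝ≥0∞) (F : Pref S 0 → ℝ≥0∞) :
    expect (κ.law 0) (fun p => f (p.2 * expect (empirical p.1) F)) = f (F PUnit.unit) := by
  have empirical_const (a : Pref S 0) : empirical (fun _ : Fin N => a) = PMF.pure a :=
    PMF.map_const _ a
  refine (expect_pure _ _).trans (congrArg f ?_)
  rw [one_mul]
  exact (congrArg (expect · F) (empirical_const PUnit.unit)).trans (expect_pure _ _)

/-- A step of the kernel realizes, on weighted means over the particles, the Feynman–Kac operator
of the model in expectation. -/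
def Unbiased (κ : WeightedKernel S N) (m : Model S) (s₀ : S 0) (T : ℕ) : Prop :=
  ∀ t < T, ∀ x (F : Pref S (t + 1) → ℝ≥0∞),
    expect (κ t x) (fun q => q.2 * expect (empirical q.1) F) =
      expect (empirical x) (m.fkStep s₀ t F)

variable {m : Model S} {s₀ : S 0} {T : ℕ} {L : ℝ}

lemma Unbiased.mul_expect_law (hκ : κ.Unbiased m s₀ T) (hR : m.RatioBound s₀ T L) {t : ℕ}
    (ht : t ≤ T) (F : Pref S t → ℝ≥0∞) :
    ENNReal.ofReal (m.V s₀ 0 PUnit.unit) *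
      expect (κ.law t) (fun p => p.2 * expect (empirical p.1) F) = m.gamma s₀ t F := by
  induction t with
  | zero =>
    exact (congrArg _ (expect_law_zero id F)).trans
      (expect_pure PUnit.unit fun x => ENNReal.ofReal (m.V s₀ 0 x) * F x).symm
  | succ t ih =>
    rw [hR.gamma_succ ht, ← ih (Nat.le_of_succ_le ht), expect_law_succ]
    simp only [mul_assoc, expect_mul_left, hκ t ht]

lemma Unbiased.expect_lookahead (hκ : κ.Unbiased m s₀ T) {r t : ℕ} (h : r + t = T) :
    expect (κ.law t) (fun p => p.2 * expect (empirical p.1) (m.lookahead s₀ r t)) =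
      m.lookahead s₀ T 0 PUnit.unit := by
  induction t generalizing r with
  | zero =>
    obtain rfl : r = T := h
    exact expect_law_zero id _
  | succ t ih =>
    rw [expect_law_succ, ← ih (r := r + 1) (by lia)]
    simp only [mul_assoc, expect_mul_left, hκ t (by lia), Model.lookahead]

lemma Unbiased.expect_weight (hκ : κ.Unbiased m s₀ T) :
    expect (κ.law T) (fun p => p.2) = m.lookahead s₀ T 0 PUnit.unit := by
  rw [← hκ.expect_lookahead (zero_add T)]
  simp only [Model.lookahead, expect_const, mul_one]

lemma expect_lookahead_sq_le {q : ℝ≥0∞}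
    (hq : ∀ r t, r + 1 + t = T → ∀ x,
      expect (κ t x) (fun p => (p.2 * expect (empirical p.1) (m.lookahead s₀ r (t + 1))) ^ 2) ≤
        q * expect (empirical x) (m.lookahead s₀ (r + 1) t) ^ 2) {r t : ℕ} (h : r + t = T) :
    expect (κ.law t) (fun p => (p.2 * expect (empirical p.1) (m.lookahead s₀ r t)) ^ 2) ≤
      q ^ t * m.lookahead s₀ T 0 PUnit.unit ^ 2 := by
  induction t generalizing r with
  | zero =>
    obtain rfl : r = T := h
    rw [pow_zero, one_mul]
    exact (expect_law_zero (· ^ 2) _).le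
  | succ t ih =>
    rw [expect_law_succ, pow_succ', mul_assoc]
    grw [← ih (r := r + 1) (by lia)]
    rw [← expect_mul_left]
    refine expect_mono _ fun p => ?_
    simp only [mul_assoc, mul_pow p.2, expect_mul_left]
    grw [hq r t (by lia) p.1]
    exact (mul_left_comm _ _ _).le

lemma expect_weight_sq_le {q : ℝ≥0∞}
    (hq : ∀ r t, r + 1 + t = T → ∀ x,
      expect (κ t x) (fun p => (p.2 * expect (empirical p.1) (m.lookahead s₀ r (t + 1))) ^ 2) ≤
        q * expect (empirical x) (m.lookahead s₀ (r + 1) t) ^ 2) :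
    expect (κ.law T) (fun p => p.2 ^ 2) ≤ q ^ T * m.lookahead s₀ T 0 PUnit.unit ^ 2 := by
  simpa only [Model.lookahead, expect_const, mul_one] using expect_lookahead_sq_le hq (zero_add T)

lemma Unbiased.target_apply (hκ : κ.Unbiased m s₀ T) (hR : m.RatioBound s₀ T L)
    (hZ0 : m.lookahead s₀ T 0 PUnit.unit ≠ 0) (hZ_top : m.lookahead s₀ T 0 PUnit.unit ≠ ∞)
    (a : Pref S T) :
    m.target s₀ T a = expect (κ.law T) fun p =>
      p.2 / m.lookahead s₀ T 0 PUnit.unit * empirical p.1 a := by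
  classical
  set Z := m.lookahead s₀ T 0 PUnit.unit
  set v := ENNReal.ofReal (m.V s₀ 0 PUnit.unit)
  have hv : v ≠ 0 := by simpa [v] using hR.1 0 (Nat.zero_le _) PUnit.unit
  have hvZ : v * Z ≠ ∞ := ENNReal.mul_ne_top ENNReal.ofReal_ne_top hZ_top
  have total : expect (m.refLaw s₀ T) (fun x => ENNReal.ofReal (m.V s₀ T x)) = v * Z := by
    have h := hκ.mul_expect_law hR le_rfl fun _ => 1
    simp only [expect_const, mul_one, hκ.expect_weight, Model.gamma] at h
    exact h.symm
  have gamma_single : m.gamma s₀ T (fun b => if b = a then 1 else 0) =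
      m.refLaw s₀ T a * ENNReal.ofReal (m.V s₀ T a) := by
    simp [Model.gamma, expect]
  have tilt_eq : m.target s₀ T a * (v * Z) = m.refLaw s₀ T a * ENNReal.ofReal (m.V s₀ T a) := by
    rw [← ENNReal.ofReal_toReal hvZ] at total ⊢
    exact tilt_apply_mul total (ENNReal.toReal_pos (mul_ne_zero hv hZ0) hvZ) a
  rw [← ENNReal.mul_left_inj (mul_ne_zero hv hZ0) hvZ, tilt_eq, ← gamma_single,
    ← hκ.mul_expect_law hR le_rfl, mul_left_comm, ← expect_mul_right]
  congr 2 with p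
  rw [expect_ite_eq, mul_right_comm, ENNReal.div_mul_cancel hZ0 hZ_top]

end WeightedKernel

section Coupling
variable {S : ℕ → Type u} {N Nm n : ℕ}

/-- The particles at the end of a round that starts from the particles `x`. -/
def nextParticles {t : ℕ} (x : Fin N → Pref S t) (r : Round (S (t + 1)) N Nm n) :
    Fin N → Pref S (t + 1) :=
  fun i => (x (r.anc i), (r.rs (r.anc i)).out)

variable [NeZero N] {κ : WeightedKernel S N} {m : Model S} {s₀ : S 0} {M : ℝ} {T : ℕ}
  {θ : ℝ≥0∞}

lemma map_particles_histLaw_succ (t : ℕ) :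
    (m.histLaw s₀ N Nm n M (t + 1)).map (particles (t + 1)) =
      ((m.histLaw s₀ N Nm n M t).map (particles t)).bind fun x =>
        (m.roundLaw s₀ t N Nm n M x).map (nextParticles x) := by
  simp only [Model.histLaw, PMF.map_bind, PMF.bind_map]
  exact congrArg _ (funext fun h => PMF.map_comp _ _ _)

lemma map_out_smc (δ' : ℝ) :
    (m.smc s₀ T N Nm M δ').map Run.out =
      ((m.histLaw s₀ N Nm (rsBudget M δ') M T).map (particles T)).bind empirical := by
  simp only [Model.smc, PMF.map_bind, PMF.bind_map, PMF.map_comp]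
  rfl

lemma minorizes_histLaw
    (hθ : ∀ t < T, ∀ x, Minorizes θ ((κ t x).map Prod.fst)
      ((m.roundLaw s₀ t N Nm n M x).map (nextParticles x))) {t : ℕ} (ht : t ≤ T) :
    Minorizes (θ ^ t) ((κ.law t).map Prod.fst)
      ((m.histLaw s₀ N Nm n M t).map (particles t)) := by
  induction t with
  | zero =>
    have h : (κ.law 0).map Prod.fst = (m.histLaw s₀ N Nm n M 0).map (particles 0) :=
      (PMF.pure_map _ _).trans (PMF.pure_map (particles 0) PUnit.unit).symm
    rw [pow_zero, h]
    exact Minorizes.refl _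
  | succ t ih =>
    rw [pow_succ, map_particles_histLaw_succ, WeightedKernel.law, PMF.map_bind]
    simpa only [PMF.bind_map, PMF.map_comp, Function.comp_def] using
      (ih (Nat.le_of_succ_le ht)).bind (hθ t ht)

lemma tvDist_target_smc_le {L : ℝ} {δ' : ℝ} {d d' : ℝ≥0} (hκ : κ.Unbiased m s₀ T)
    (hR : m.RatioBound s₀ T L) (hZ0 : m.lookahead s₀ T 0 PUnit.unit ≠ 0)
    (hZ_top : m.lookahead s₀ T 0 PUnit.unit ≠ ∞)
    (hX : 1 ≤ expect (κ.law T) (fun p => min (p.2 / m.lookahead s₀ T 0 PUnit.unit) 1) + d)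
    (hθ : ∀ t < T, ∀ x, Minorizes θ ((κ t x).map Prod.fst)
      ((m.roundLaw s₀ t N Nm (rsBudget M δ') M x).map (nextParticles x)))
    (hd' : 1 ≤ θ ^ T + d') :
    tvDist (m.target s₀ T) ((m.smc s₀ T N Nm M δ').map Run.out) ≤ d + d' := by
  refine (tvDist_triangle _ (((κ.law T).map Prod.fst).bind empirical) _).trans
    (add_le_add ?_ ?_)
  · rw [PMF.bind_map]
    exact tvDist_bind_le (hκ.target_apply hR hZ0 hZ_top) hX
  · rw [map_out_smc]
    exact ((minorizes_histLaw hθ le_rfl).bind_right empirical).tvDist_le hd'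

end Coupling

/-! ### One round of the ideal sampler -/

lemma sum_mul_expect_categorical {N : ℕ} [NeZero N] (w : Fin N → ℝ) (f : Fin N → ℝ≥0∞) :
    (∑ j, ENNReal.ofReal (w j)) * expect (categorical w) f = ∑ j, ENNReal.ofReal (w j) * f j := by
  obtain h0 | h0 := eq_or_ne (∑ j, ENNReal.ofReal (w j)) 0
  · rw [h0, zero_mul]
    refine (Finset.sum_eq_zero fun j hj => ?_).symm
    rw [Finset.sum_eq_zero_iff.1 h0 j hj, zero_mul]
  · have norm_mul (j : Fin N) :
        categorical w j * ∑ i, ENNReal.ofReal (w i) = ENNReal.ofReal (w j) := by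
      have h := normalizeOr_apply_mul_tsum (PMF.uniformOfFintype (Fin N))
        (w := fun i => ENNReal.ofReal (w i)) (by rwa [tsum_fintype]) (by simp [tsum_fintype]) j
      rwa [tsum_fintype] at h
    rw [expect, tsum_fintype, Finset.mul_sum]
    refine Finset.sum_congr rfl fun j _ => ?_
    rw [← mul_assoc, mul_comm _ (categorical w j), norm_mul]

lemma expect_resample {N : ℕ} [NeZero N] (w : Fin N → ℝ) (f : Fin N → ℝ≥0∞) :
    expect (indep N fun _ => categorical w)
        (fun anc => (∑ j, ENNReal.ofReal (w j)) / N * ((∑ i, f (anc i)) / N)) =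
      (∑ j, ENNReal.ofReal (w j) * f j) / N := by
  rw [expect_mul_left, expect_indep_mean, ← sum_mul_expect_categorical]
  simp only [div_eq_mul_inv, mul_right_comm]

lemma expect_resample_sq_le {N : ℕ} [NeZero N] (w : Fin N → ℝ) {f : Fin N → ℝ≥0∞} {b : ℝ≥0∞}
    (hf : ∀ j, WithinFactor b (f j)) :
    expect (indep N fun _ => categorical w)
        (fun anc => ((∑ j, ENNReal.ofReal (w j)) / N * ((∑ i, f (anc i)) / N)) ^ 2) ≤
      (1 + b ^ 4 / N) * ((∑ j, ENNReal.ofReal (w j) * f j) / N) ^ 2 := by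
  have mean_ge : 1 ≤ b * expect (categorical w) f :=
    (WithinFactor.expect _ fun j _ => hf j).2
  have sq_le : expect (categorical w) (fun j => f j ^ 2) ≤ b ^ 2 :=
    expect_le _ fun j => by gcongr; exact (hf j).1
  have sum_const_div (a : ℝ≥0∞) : (∑ _ : Fin N, a) / N = a := by
    simp [mul_comm, ENNReal.mul_div_cancel_right, NeZero.ne N]
  simp only [mul_pow, expect_mul_left]
  grw [expect_indep_mean_sq_le_mul (fun _ => mean_ge) fun _ => sq_le]
  rw [sum_const_div, ← sum_mul_expect_categorical]
  exact le_of_eq (by simp only [div_eq_mul_inv]; ring)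

namespace Model
variable {S : ℕ → Type u} (m : Model S) (s₀ : S 0) {N Nm : ℕ} [NeZero N]

/-- The Monte-Carlo estimate of the incremental weight of the prefix `x` from the draws `y`. -/
noncomputable def mcWeight (t : ℕ) (x : Pref S t) (y : Fin Nm → S (t + 1)) : ℝ :=
  ((∑ k, m.nextV s₀ t x (y k)) / Nm) / m.V s₀ t x

/-- The weighting and resampling part of a round that extends the particles `x` by the states `ys`.
The weight of the system changes by the factor `c t x mc`, where `mc` are the Monte-Carlo draws. -/
noncomputable def selectLaw
    (c : (t : ℕ) → (Fin N → Pref S t) → (Fin N → Fin Nm → S (t + 1)) → ℝ≥0∞)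
    (t : ℕ) (x : Fin N → Pref S t) (ys : Fin N → S (t + 1)) :
    PMF ((Fin N → Pref S (t + 1)) × ℝ≥0∞) :=
  (indep N fun j => indep Nm fun _ => m.ref s₀ t (x j)).bind fun mc =>
    (indep N fun _ => categorical fun j => m.mcWeight s₀ t (x j) (mc j)).map fun anc =>
      (fun i => (x (anc i), ys (anc i)), c t x mc)

/-- A round of the sampler in which rejection sampling is replaced by exact draws from the optimal
proposal. -/
noncomputable def idealRound
    (c : (t : ℕ) → (Fin N → Pref S t) → (Fin N → Fin Nm → S (t + 1)) → ℝ≥0∞) :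
    WeightedKernel S N :=
  fun t x => (indep N fun i => m.optProposal s₀ t (x i)).bind (m.selectLaw s₀ c t x)

/-- The mean Monte-Carlo weight of the particles. -/
noncomputable def meanWeight (t : ℕ) (x : Fin N → Pref S t) (mc : Fin N → Fin Nm → S (t + 1)) :
    ℝ≥0∞ :=
  (∑ j, ENNReal.ofReal (m.mcWeight s₀ t (x j) (mc j))) / N

/-- The exact incremental weight of a single particle. -/
noncomputable def soleWeight (t : ℕ) (x : Fin 1 → Pref S t) (_ : Fin 1 → Fin Nm → S (t + 1)) :
    ℝ≥0∞ :=
  m.weight s₀ t (x 0)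

variable {m s₀} {T t : ℕ} {L ε : ℝ}
  {c : (t : ℕ) → (Fin N → Pref S t) → (Fin N → Fin Nm → S (t + 1)) → ℝ≥0∞}

lemma expect_idealRound (x : Fin N → Pref S t) (F : Pref S (t + 1) → ℝ≥0∞) (f : ℝ≥0∞ → ℝ≥0∞) :
    expect (m.idealRound s₀ c t x) (fun q => f (q.2 * expect (empirical q.1) F)) =
      expect (indep N fun j => m.optProposal s₀ t (x j)) fun ys =>
        expect (indep N fun j => indep Nm fun _ => m.ref s₀ t (x j)) fun mc =>
          expect (indep N fun _ => categorical fun j => m.mcWeight s₀ t (x j) (mc j)) fun anc =>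
            f (c t x mc * ((∑ i, F (x (anc i), ys (anc i))) / N)) := by
  simp only [idealRound, selectLaw, expect_bind, expect_map]
  congr! 7 with ys mc anc
  exact congrArg (c t x mc * ·) (expect_empirical (fun i => (x (anc i), ys (anc i))) F)

lemma map_nextParticles_roundLaw {n : ℕ} (M : ℝ) (x : Fin N → Pref S t) :
    (m.roundLaw s₀ t N Nm n M x).map (nextParticles x) =
      (indep N fun i => (rejectionSampling (m.nextV s₀ t (x i)) (m.ref s₀ t (x i)) M n).map
        RSRun.out).bind fun ys => (m.selectLaw s₀ c t x ys).map Prod.fst := by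
  simp only [← indep_map, PMF.bind_map, roundLaw, selectLaw, PMF.map_bind, PMF.map_comp]
  rfl

lemma minorizes_roundLaw (hR : m.RatioBound s₀ T L) (hB : m.BellmanBound s₀ T ε) {B δ' : ℝ}
    (hLB : L * (1 + ε) ≤ B) (hδ0 : 0 < δ') (hδ1 : δ' ≤ 1) (ht : t < T) (x : Fin N → Pref S t) :
    Minorizes ((1 - ENNReal.ofReal δ') ^ N) ((m.idealRound s₀ c t x).map Prod.fst)
      ((m.roundLaw s₀ t N Nm (rsBudget (4 * B) δ') (4 * B) x).map (nextParticles x)) := by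
  rw [map_nextParticles_roundLaw (c := c), idealRound, PMF.map_bind]
  refine (Minorizes.indep fun i => ?_).bind_right _
  have nextV_le (y : S (t + 1)) :
      m.nextV s₀ t (x i) y ≤ B * m.expNext s₀ t (x i) := calc
    m.nextV s₀ t (x i) y ≤ L * m.V s₀ t (x i) := hR.nextV_le ht _ y
    _ ≤ L * ((1 + ε) * m.expNext s₀ t (x i)) :=
      mul_le_mul_of_nonneg_left (hB.le_expNext hR ht _) (hR.pos ht (x i)).le
    _ ≤ B * m.expNext s₀ t (x i) := by
      rw [← mul_assoc]
      exact mul_le_mul_of_nonneg_right hLB (hR.expNext_pos ht _).le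
  obtain ⟨y, -⟩ := (m.ref s₀ t (x i)).support_nonempty
  have hB0 : 0 < B := pos_of_mul_pos_left ((hR.nextV_pos ht _ y).trans_le (nextV_le y))
    (hR.expNext_pos ht _).le
  exact minorizes_rejectionSampling (fun y => (hR.nextV_pos ht _ y).le) (hR.expect_nextV ht _)
    (hR.expNext_pos ht _) hB0 nextV_le hδ0 hδ1

section MonteCarlo
variable [NeZero Nm]

lemma RatioBound.ofReal_mcWeight (hR : m.RatioBound s₀ T L) (ht : t < T) (x : Pref S t)
    (y : Fin Nm → S (t + 1)) :
    ENNReal.ofReal (m.mcWeight s₀ t x y) = (∑ k, m.ratio s₀ t x (y k)) / Nm := by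
  have hV := hR.1 t ht.le x
  rw [mcWeight, div_right_comm, Finset.sum_div,
    ENNReal.ofReal_div_of_pos (by simpa using NeZero.pos Nm), ENNReal.ofReal_natCast,
    ENNReal.ofReal_sum_of_nonneg fun k _ => (div_pos (hR.nextV_pos ht x _) hV).le]
  rfl

lemma RatioBound.expect_mcWeight (hR : m.RatioBound s₀ T L) (ht : t < T) (x : Pref S t) :
    expect (indep Nm fun _ => m.ref s₀ t x) (fun y => ENNReal.ofReal (m.mcWeight s₀ t x y)) =
      m.weight s₀ t x := by
  simp only [hR.ofReal_mcWeight ht]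
  exact expect_indep_mean _ _

lemma RatioBound.expect_mcWeight_sq_le (hR : m.RatioBound s₀ T L) (ht : t < T) (hL : L ≤ Nm)
    (x : Pref S t) :
    expect (indep Nm fun _ => m.ref s₀ t x)
        (fun y => ENNReal.ofReal (m.mcWeight s₀ t x y) ^ 2) ≤
      m.weight s₀ t x + m.weight s₀ t x ^ 2 := by
  simp only [hR.ofReal_mcWeight ht]
  grw [expect_indep_mean_sq_le]
  refine add_le_add_left (ENNReal.div_le_of_le_mul' ?_) _
  rw [weight, ← expect_mul_left]
  refine expect_mono _ fun y => ?_
  rw [sq]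
  gcongr
  exact (hR.ratio_le ht x y).trans (ENNReal.ofReal_le_of_le_toReal (by simpa using hL))

end MonteCarlo

end Model

namespace Model
variable {S : ℕ → Type u} {m : Model S} {s₀ : S 0} {T t : ℕ} {L ε : ℝ}

lemma withinFactor_fkStep (hR : m.RatioBound s₀ T L) (ht : t < T) {b c : ℝ≥0∞} {x : Pref S t}
    (hw : WithinFactor b (m.weight s₀ t x)) {F : Pref S (t + 1) → ℝ≥0∞}
    (hF : ∀ x, WithinFactor c (F x)) : WithinFactor (b * c) (m.fkStep s₀ t F x) := by
  rw [← hR.weight_mul_expect_optProposal ht]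
  exact hw.mul (.expect _ fun y _ => hF (x, y))

lemma withinFactor_lookahead (hR : m.RatioBound s₀ T L) (hB : m.BellmanBound s₀ T ε) {r : ℕ}
    (h : r + t ≤ T) (x : Pref S t) :
    WithinFactor (ENNReal.ofReal (Real.exp ε) ^ r) (m.lookahead s₀ r t x) := by
  induction r generalizing t with
  | zero => exact (pow_zero (ENNReal.ofReal (Real.exp ε))).symm ▸ WithinFactor.one
  | succ r ih =>
    rw [pow_succ']
    exact withinFactor_fkStep hR (by lia) (hB.withinFactor_weight hR (by lia) x)
      (ih (t := t + 1) (by lia))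

section MeanWeight
variable {N Nm : ℕ} [NeZero Nm]

lemma RatioBound.expect_mcWeight_mean_sq_le (hR : m.RatioBound s₀ T L) (ht : t < T) (hL : L ≤ Nm)
    {b : ℝ≥0∞} {x : Fin N → Pref S t} (hw : ∀ j, WithinFactor b (m.weight s₀ t (x j)))
    {f : Fin N → ℝ≥0∞} (hf : ∀ j, WithinFactor b (f j)) :
    expect (indep N fun j => indep Nm fun _ => m.ref s₀ t (x j))
        (fun mc => ((∑ j, ENNReal.ofReal (m.mcWeight s₀ t (x j) (mc j)) * f j) / N) ^ 2) ≤
      (1 + 2 * b ^ 8 / N) * ((∑ j, m.weight s₀ t (x j) * f j) / N) ^ 2 := by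
  have mean_eq (j : Fin N) : expect (indep Nm fun _ => m.ref s₀ t (x j))
        (fun y => ENNReal.ofReal (m.mcWeight s₀ t (x j) y) * f j) =
      m.weight s₀ t (x j) * f j := by
    rw [expect_mul_right, hR.expect_mcWeight ht]
  have mean_ge (j : Fin N) :
      1 ≤ b ^ 2 * expect (indep Nm fun _ => m.ref s₀ t (x j))
        fun y => ENNReal.ofReal (m.mcWeight s₀ t (x j) y) * f j := by
    rw [mean_eq, sq]
    exact ((hw j).mul (hf j)).2
  have sq_le (j : Fin N) :
      expect (indep Nm fun _ => m.ref s₀ t (x j))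
        (fun y => (ENNReal.ofReal (m.mcWeight s₀ t (x j) y) * f j) ^ 2) ≤ 2 * b ^ 4 := by
    have weight_le : m.weight s₀ t (x j) ≤ b ^ 2 :=
      (hw j).1.trans (le_self_pow₀ (hw j).one_le two_ne_zero)
    simp only [mul_pow, expect_mul_right]
    calc _ ≤ (m.weight s₀ t (x j) + m.weight s₀ t (x j) ^ 2) * f j ^ 2 := by
          gcongr; exact hR.expect_mcWeight_sq_le ht hL _
      _ ≤ (b ^ 2 + b ^ 2) * b ^ 2 := by gcongr; exacts [(hw j).1, (hf j).1]
      _ = 2 * b ^ 4 := by ring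
  have h := expect_indep_mean_sq_le_mul mean_ge sq_le
  simp only [mean_eq] at h
  exact h.trans_eq (by ring_nf)

variable [NeZero N]

lemma unbiased_idealRound_meanWeight (hR : m.RatioBound s₀ T L) :
    (m.idealRound (N := N) (Nm := Nm) s₀ (m.meanWeight s₀)).Unbiased m s₀ T := by
  intro t ht x F
  have resample (ys : Fin N → S (t + 1)) (mc : Fin N → Fin Nm → S (t + 1)) :=
    expect_resample (fun j => m.mcWeight s₀ t (x j) (mc j)) fun j => F (x j, ys j)
  have weights (ys : Fin N → S (t + 1)) :=
    expect_indep_sum (fun j => indep Nm fun _ => m.ref s₀ t (x j))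
      fun j y => ENNReal.ofReal (m.mcWeight s₀ t (x j) y) * F (x j, ys j)
  have propagate := expect_indep_sum (fun j => m.optProposal s₀ t (x j))
    fun j y => m.weight s₀ t (x j) * F (x j, y)
  refine (expect_idealRound x F id).trans ?_
  simp only [id, meanWeight, resample, expect_empirical]
  simp only [div_eq_mul_inv, expect_mul_right, weights, hR.expect_mcWeight ht, propagate,
    expect_mul_left, hR.weight_mul_expect_optProposal ht]

lemma RatioBound.expect_optProposal_mean_sq_le (hR : m.RatioBound s₀ T L) (ht : t < T)
    {b : ℝ≥0∞} {x : Fin N → Pref S t} (hw : ∀ j, WithinFactor b (m.weight s₀ t (x j)))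
    {F : Pref S (t + 1) → ℝ≥0∞} (hF : ∀ x, WithinFactor b (F x)) :
    expect (indep N fun j => m.optProposal s₀ t (x j))
        (fun ys => ((∑ j, m.weight s₀ t (x j) * F (x j, ys j)) / N) ^ 2) ≤
      (1 + b ^ 8 / N) * expect (empirical x) (m.fkStep s₀ t F) ^ 2 := by
  have mean_eq (j : Fin N) :
      expect (m.optProposal s₀ t (x j)) (fun y => m.weight s₀ t (x j) * F (x j, y)) =
        m.fkStep s₀ t F (x j) := by
    rw [expect_mul_left, hR.weight_mul_expect_optProposal ht]
  have mean_ge (j : Fin N) :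
      1 ≤ b ^ 2 * expect (m.optProposal s₀ t (x j))
        fun y => m.weight s₀ t (x j) * F (x j, y) := by
    rw [mean_eq, sq]
    exact (withinFactor_fkStep hR ht (hw j) hF).2
  have sq_le (j : Fin N) :
      expect (m.optProposal s₀ t (x j)) (fun y => (m.weight s₀ t (x j) * F (x j, y)) ^ 2) ≤
        b ^ 4 := by
    refine expect_le _ fun y => ?_
    grw [(hw j).1, (hF (x j, y)).1]
    exact le_of_eq (by ring)
  have h := expect_indep_mean_sq_le_mul mean_ge sq_le
  simp only [mean_eq] at h
  rw [expect_empirical]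
  exact h.trans_eq (by ring_nf)

lemma RatioBound.expect_meanWeight_sq_le (hR : m.RatioBound s₀ T L) (ht : t < T) (hL : L ≤ Nm)
    {b : ℝ≥0∞} (hw : ∀ x, WithinFactor b (m.weight s₀ t x)) {F : Pref S (t + 1) → ℝ≥0∞}
    (hF : ∀ x, WithinFactor b (F x)) (x : Fin N → Pref S t) :
    expect (m.idealRound (Nm := Nm) s₀ (m.meanWeight s₀) t x)
        (fun q => (q.2 * expect (empirical q.1) F) ^ 2) ≤
      (1 + 2 * b ^ 8 / N) ^ 3 * expect (empirical x) (m.fkStep s₀ t F) ^ 2 := by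
  have hb : b ^ 4 ≤ b ^ 8 := pow_le_pow_right₀ (hw (x 0)).one_le (by simp)
  have resample (ys : Fin N → S (t + 1)) (mc : Fin N → Fin Nm → S (t + 1)) :=
    expect_resample_sq_le (fun j => m.mcWeight s₀ t (x j) (mc j)) fun j => hF (x j, ys j)
  have weights (ys : Fin N → S (t + 1)) :=
    hR.expect_mcWeight_mean_sq_le ht hL (fun j => hw (x j)) fun j => hF (x j, ys j)
  have propagate := hR.expect_optProposal_mean_sq_le ht (fun j => hw (x j)) hF
  rw [expect_idealRound x F (· ^ 2)]
  simp only [meanWeight]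
  refine (expect_mono _ fun ys => expect_mono _ fun mc => resample ys mc).trans ?_
  simp only [expect_mul_left]
  grw [expect_mono _ weights, expect_mul_left, propagate]
  have coeff_le : (1 + b ^ 4 / N) * ((1 + 2 * b ^ 8 / N) * (1 + b ^ 8 / N)) ≤
      (1 + 2 * b ^ 8 / N) ^ 3 := by
    have le_two : b ^ 8 ≤ 2 * b ^ 8 := le_mul_of_one_le_left' one_le_two
    calc _ ≤ (1 + 2 * b ^ 8 / N) * ((1 + 2 * b ^ 8 / N) * (1 + 2 * b ^ 8 / N)) := by
          gcongr; exact hb.trans le_two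
      _ = _ := by ring
  simpa only [mul_assoc] using mul_le_mul_left coeff_le _

end MeanWeight

section SoleWeight
variable {Nm : ℕ}

lemma unbiased_idealRound_soleWeight (hR : m.RatioBound s₀ T L) :
    (m.idealRound (N := 1) (Nm := Nm) s₀ (m.soleWeight s₀)).Unbiased m s₀ T := by
  intro t ht x F
  have anc_eq (anc : Fin 1 → Fin 1) : anc 0 = 0 := Subsingleton.elim _ _
  refine (expect_idealRound x F id).trans ?_
  simp only [id, soleWeight, Fin.sum_univ_one, anc_eq, expect_const, Nat.cast_one, div_one,
    expect_mul_left, expect_empirical]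
  rw [expect_indep_apply (fun j => m.optProposal s₀ t (x j)) (fun y => F (x 0, y)) 0,
    hR.weight_mul_expect_optProposal ht]

lemma mem_support_idealRound_soleWeight {x : Fin 1 → Pref S t}
    {q : (Fin 1 → Pref S (t + 1)) × ℝ≥0∞}
    (hq : q ∈ (m.idealRound (Nm := Nm) s₀ (m.soleWeight s₀) t x).support) :
    q.2 = m.weight s₀ t (x 0) := by
  obtain ⟨ys, -, hq⟩ := (PMF.mem_support_bind_iff _ _ _).1 hq
  obtain ⟨mc, -, hq⟩ := (PMF.mem_support_bind_iff _ _ _).1 hq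
  obtain ⟨anc, -, rfl⟩ := (PMF.mem_support_map_iff _ _ _).1 hq
  rfl

end SoleWeight

end Model

/-! ### Distance of the output law to the target -/

lemma one_le_pow_add {θ d : ℝ≥0∞} (hθ : θ ≤ 1) (h : 1 ≤ θ + d) (n : ℕ) : 1 ≤ θ ^ n + n * d := by
  induction n with
  | zero => simp
  | succ n ih =>
    calc 1 ≤ θ ^ n * 1 + n * d := by rwa [mul_one]
      _ ≤ θ ^ n * (θ + d) + n * d := by gcongr
      _ = θ ^ (n + 1) + (θ ^ n * d + n * d) := by ring
      _ ≤ θ ^ (n + 1) + (1 * d + n * d) := by gcongr; exact pow_le_one' hθ n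
      _ = θ ^ (n + 1) + (n + 1 : ℕ) * d := by push_cast; ring

lemma one_le_add_ofReal_of_one_le_exp_mul {x : ℝ} {e : ℝ≥0∞}
    (h : 1 ≤ ENNReal.ofReal (Real.exp x) * e) : 1 ≤ e + ENNReal.ofReal x := by
  have exp_neg_le : ENNReal.ofReal (Real.exp (-x)) ≤ e := calc
    ENNReal.ofReal (Real.exp (-x))
      ≤ ENNReal.ofReal (Real.exp (-x)) * (ENNReal.ofReal (Real.exp x) * e) :=
        le_mul_of_one_le_right' h
    _ = e := by
      rw [← mul_assoc, ← ENNReal.ofReal_mul (Real.exp_nonneg _), ← Real.exp_add, neg_add_cancel,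
        Real.exp_zero, ENNReal.ofReal_one, one_mul]
  calc 1 = ENNReal.ofReal (1 - x + x) := by simp
    _ ≤ ENNReal.ofReal (1 - x) + ENNReal.ofReal x := ENNReal.ofReal_add_le
    _ ≤ e + ENNReal.ofReal x := by
      gcongr
      exact (ENNReal.ofReal_le_ofReal (Real.one_sub_le_exp_neg x)).trans exp_neg_le

lemma one_add_pow_le {u : ℝ} (hu : 0 ≤ u) {n : ℕ} (h : n * u ≤ 1) :
    (1 + u) ^ n ≤ 1 + 2 * (n * u) := by
  have hnu : 0 ≤ n * u := by positivity
  have exp_le := Real.abs_exp_sub_one_sub_id_le (x := n * u) (by rwa [abs_of_nonneg hnu])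
  calc (1 + u) ^ n ≤ Real.exp u ^ n := by
        gcongr
        linarith [Real.add_one_le_exp u]
    _ = Real.exp (n * u) := (Real.exp_nat_mul u n).symm
    _ ≤ 1 + 2 * (n * u) := by nlinarith [abs_le.1 exp_le]

lemma one_add_div_pow_le {u l : ℝ} {n N : ℕ} [NeZero N] (hu : 0 ≤ u) (hl : 0 ≤ l)
    (hN : n * u ≤ N) (hlN : 2 * (n * u) ≤ l ^ 2 * N) :
    (1 + ENNReal.ofReal u / N) ^ n ≤ 1 + ENNReal.ofReal l ^ 2 := by
  have hN0 : (0 : ℝ) < N := by simpa using NeZero.pos N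
  have real_le : (1 + u / N) ^ n ≤ 1 + l ^ 2 := by
    have mean_le : n * (u / N) ≤ 1 := by rwa [← mul_div_assoc, div_le_one hN0]
    refine (one_add_pow_le (by positivity) mean_le).trans ?_
    rw [← mul_div_assoc, ← mul_div_assoc]
    gcongr
    rwa [div_le_iff₀ hN0]
  have h := ENNReal.ofReal_le_ofReal real_le
  rwa [ENNReal.ofReal_pow (by positivity), ENNReal.ofReal_add zero_le_one (by positivity),
    ENNReal.ofReal_add zero_le_one (by positivity), ENNReal.ofReal_div_of_pos hN0,
    ENNReal.ofReal_natCast, ENNReal.ofReal_pow hl, ENNReal.ofReal_one] at h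

namespace WithinFactor

lemma one_le_mul_min_div {b c x y : ℝ≥0∞} (hx : WithinFactor b x) (hy : WithinFactor c y)
    (hc : c ≠ ∞) : 1 ≤ b * c * min (x / y) 1 := by
  have hbc : 1 ≤ b * c := one_le_mul hx.one_le hy.one_le
  have one_le_mul_div : 1 ≤ b * c * (x / y) := by
    rw [← mul_div_assoc, ENNReal.le_div_iff_mul_le (.inl hy.ne_zero) (.inl (hy.ne_top hc)), one_mul]
    calc y ≤ c * 1 := by rw [mul_one]; exact hy.1
      _ ≤ c * (b * x) := by gcongr; exact hx.2
      _ = b * c * x := by ring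
  rcases min_choice (x / y) 1 with h | h <;> rw [h]
  exacts [one_le_mul_div, by rwa [mul_one]]

end WithinFactor

namespace Model
variable {S : ℕ → Type u} {m : Model S} {s₀ : S 0} {T : ℕ} {L ε B δ' : ℝ}

section Overlap
variable {N Nm : ℕ} [NeZero N]
  {c : (t : ℕ) → (Fin N → Pref S t) → (Fin N → Fin Nm → S (t + 1)) → ℝ≥0∞}

lemma tvDist_target_smc_le_of_idealRound (hR : m.RatioBound s₀ T L) (hB : m.BellmanBound s₀ T ε)
    (hLB : L * (1 + ε) ≤ B) (hδ0 : 0 < δ') (hδ1 : δ' ≤ 1)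
    (hc : (m.idealRound s₀ c).Unbiased m s₀ T) {d : ℝ} (hd : 0 ≤ d)
    (hX : 1 ≤ expect ((m.idealRound s₀ c).law T)
      (fun p => min (p.2 / m.lookahead s₀ T 0 PUnit.unit) 1) + ENNReal.ofReal d) :
    tvDist (m.target s₀ T) ((m.smc s₀ T N Nm (4 * B) δ').map Run.out) ≤ d + δ' * (N * T) := by
  have hZ := withinFactor_lookahead hR hB (t := 0) (r := T) le_rfl PUnit.unit
  have no_failure : 1 ≤ ((1 - ENNReal.ofReal δ') ^ N) ^ T + (δ'.toNNReal * (N * T) : ℝ≥0) := by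
    rw [← pow_mul]
    refine (one_le_pow_add tsub_le_self
      (le_tsub_add (a := ENNReal.ofReal δ')) (N * T)).trans_eq ?_
    push_cast
    rw [mul_comm (_ * _ : ℝ≥0∞)]
    rfl
  refine (tvDist_target_smc_le hc hR hZ.ne_zero (hZ.ne_top (ENNReal.pow_ne_top
    ENNReal.ofReal_ne_top)) hX (fun t ht x => minorizes_roundLaw hR hB hLB hδ0 hδ1 ht x)
    no_failure).trans_eq ?_
  push_cast
  rw [Real.coe_toNNReal d hd, Real.coe_toNNReal δ' hδ0.le]

end Overlap

lemma tvDist_target_smc_one_le (hR : m.RatioBound s₀ T L) (hB : m.BellmanBound s₀ T ε)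
    (hε : 0 ≤ ε) (hLB : L * (1 + ε) ≤ B) (hδ0 : 0 < δ') (hδ1 : δ' ≤ 1) (Nm : ℕ) :
    tvDist (m.target s₀ T) ((m.smc s₀ T 1 Nm (4 * B) δ').map Run.out) ≤
      2 * (ε * T) + δ' * ((1 : ℕ) * T) := by
  refine tvDist_target_smc_le_of_idealRound hR hB hLB hδ0 hδ1 (unbiased_idealRound_soleWeight hR)
    (by positivity) (one_le_add_ofReal_of_one_le_exp_mul ?_)
  have hZ := withinFactor_lookahead hR hB (t := 0) (r := T) le_rfl PUnit.unit
  have weight_mem := WeightedKernel.withinFactor_weight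
    (κ := m.idealRound (N := 1) (Nm := Nm) s₀ (m.soleWeight s₀))
    (fun t ht x q hq => mem_support_idealRound_soleWeight hq ▸ hB.withinFactor_weight hR ht (x 0))
    le_rfl
  have exp_eq : ENNReal.ofReal (Real.exp (2 * (ε * T))) =
      ENNReal.ofReal (Real.exp ε) ^ T * ENNReal.ofReal (Real.exp ε) ^ T := by
    rw [← ENNReal.ofReal_pow (Real.exp_nonneg _), ← ENNReal.ofReal_mul (by positivity),
      ← Real.exp_nat_mul, ← Real.exp_add]
    ring_nf
  rw [exp_eq, ← expect_mul_left]
  exact le_expect_of_support _ fun p hp => (weight_mem p hp).one_le_mul_min_div hZ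
    (ENNReal.pow_ne_top ENNReal.ofReal_ne_top)

section LargeSystem
variable {N Nm : ℕ} [NeZero N] [NeZero Nm] {c : ℝ}

lemma expect_law_meanWeight_sq_le (hR : m.RatioBound s₀ T L) (hB : m.BellmanBound s₀ T ε)
    (hε : 0 ≤ ε) (hεT : ε * T ≤ c) (hL : L ≤ Nm) :
    expect ((m.idealRound (N := N) (Nm := Nm) s₀ (m.meanWeight s₀)).law T) (fun p => p.2 ^ 2) ≤
      (1 + ENNReal.ofReal (2 * Real.exp c ^ 8) / N) ^ (3 * T) *
        m.lookahead s₀ T 0 PUnit.unit ^ 2 := by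
  have exp_pow_le {r : ℕ} (hr : r ≤ T) :
      ENNReal.ofReal (Real.exp ε) ^ r ≤ ENNReal.ofReal (Real.exp c) := by
    rw [← ENNReal.ofReal_pow (Real.exp_nonneg _), ← Real.exp_nat_mul, mul_comm]
    refine ENNReal.ofReal_le_ofReal (Real.exp_le_exp.2 (le_trans ?_ hεT))
    gcongr
  rw [ENNReal.ofReal_mul zero_le_two, ENNReal.ofReal_ofNat,
    ENNReal.ofReal_pow (Real.exp_nonneg _), pow_mul]
  refine WeightedKernel.expect_weight_sq_le fun r t hrt x => ?_
  refine hR.expect_meanWeight_sq_le (by lia) hL (fun x => ?_) (fun x => ?_) x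
  · exact (hB.withinFactor_weight hR (by lia) x).mono
      ((pow_one _).symm.trans_le (exp_pow_le (by lia)))
  · exact (withinFactor_lookahead hR hB (by lia) x).mono (exp_pow_le (by lia))

lemma tvDist_target_smc_le_of_le_card (hR : m.RatioBound s₀ T L) (hB : m.BellmanBound s₀ T ε)
    (hε : 0 ≤ ε) (hLB : L * (1 + ε) ≤ B) (hδ0 : 0 < δ') (hδ1 : δ' ≤ 1) (hεT : ε * T ≤ c)
    (hL : L ≤ Nm) {l : ℝ} (hl : 0 < l) (hN : 6 * Real.exp c ^ 8 * T ≤ N)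
    (hlN : 12 * Real.exp c ^ 8 * T ≤ l ^ 2 * N) :
    tvDist (m.target s₀ T) ((m.smc s₀ T N Nm (4 * B) δ').map Run.out) ≤
      l / 2 + δ' * (N * T) := by
  have unbiased := unbiased_idealRound_meanWeight (N := N) (Nm := Nm) hR
  have hZ := withinFactor_lookahead hR hB (t := 0) (r := T) le_rfl PUnit.unit
  have mul_inv_Z := ENNReal.mul_inv_cancel hZ.ne_zero
    (hZ.ne_top (ENNReal.pow_ne_top ENNReal.ofReal_ne_top))
  have growth_le :
      (1 + ENNReal.ofReal (2 * Real.exp c ^ 8) / N) ^ (3 * T) ≤ 1 + ENNReal.ofReal l ^ 2 :=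
    one_add_div_pow_le (by positivity) hl.le (by push_cast; linarith) (by push_cast; linarith)
  lift l to ℝ≥0 using hl.le
  refine tvDist_target_smc_le_of_idealRound hR hB hLB hδ0 hδ1 unbiased (by positivity) ?_
  refine (one_le_expect_min_add (l := l) (by simpa using hl) ?_ ?_).trans_eq
    (congrArg _ (ENNReal.ofReal_coe_nnreal (p := l / 2)).symm)
  · simp only [div_eq_mul_inv, expect_mul_right]
    rw [unbiased.expect_weight, mul_inv_Z]
  · simp only [div_eq_mul_inv, mul_pow, expect_mul_right]
    grw [expect_law_meanWeight_sq_le hR hB hε hεT hL, growth_le]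
    rw [mul_assoc, ← mul_pow, mul_inv_Z, ENNReal.ofReal_coe_nnreal, one_pow, mul_one]

end LargeSystem

end Model

/-! ### Choice of the parameters -/

section ParticleCount

/-- The number of particles: one if the accumulated Bellman error `ε T` is negligible at accuracy
`δTV`, and of order `T / δTV ^ 2` otherwise. -/
noncomputable def particleCount (A ε δTV : ℝ) (T : ℕ) : ℕ :=
  if ε * T ≤ δTV / 4 then 1 else ⌈A * T * (1 + 1 / δTV ^ 2)⌉₊

/-- The constant in the bounds on the number of particle updates, `particleCount A ε δTV T * T`, at
accuracies `δTV ≤ c`. -/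
def updateConst (A c : ℝ) : ℝ := 1 + c + 4 * (A * (c ^ 2 + 1) + c ^ 2)

variable {A c ε δTV : ℝ} {T : ℕ}

lemma one_le_updateConst (hA : 0 ≤ A) (hc : 0 ≤ c) : 1 ≤ updateConst A c := by
  have : 0 ≤ c + 4 * (A * (c ^ 2 + 1) + c ^ 2) := by positivity
  unfold updateConst
  linarith

lemma particleCount_pos (hA : 0 < A) (hT : 1 ≤ T) : 0 < particleCount A ε δTV T := by
  unfold particleCount
  split_ifs
  exacts [one_pos, Nat.ceil_pos.2 (by positivity)]

lemma ceil_mul_le (hA : 0 ≤ A) (hT : 1 ≤ T) (hδ : 0 < δTV) (hδc : δTV ≤ c) :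
    (⌈A * T * (1 + 1 / δTV ^ 2)⌉₊ : ℝ) * T ≤ (A * (c ^ 2 + 1) + c ^ 2) * (T / δTV) ^ 2 := by
  have hT' : (1 : ℝ) ≤ T := mod_cast hT
  have one_le_div : 1 ≤ c ^ 2 / δTV ^ 2 := by
    rw [le_div_iff₀ (by positivity), one_mul]
    gcongr
  calc _ ≤ (A * T * (1 + 1 / δTV ^ 2) + 1) * T := by
        gcongr
        exact (Nat.ceil_lt_add_one (by positivity)).le
    _ ≤ (A * T * (c ^ 2 / δTV ^ 2 + 1 / δTV ^ 2) + T * (c ^ 2 / δTV ^ 2)) * T := by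
        gcongr
        exact one_le_mul_of_one_le_of_one_le hT' one_le_div
    _ = _ := by ring

lemma particleCount_mul_le_cube (hA : 0 ≤ A) (hT : 1 ≤ T) (hδ : 0 < δTV) (hδc : δTV ≤ c) :
    (particleCount A ε δTV T : ℝ) * T ≤ updateConst A c * (1 + T / δTV) ^ 3 := by
  have hc : 0 < c := hδ.trans_le hδc
  have hR : 0 ≤ T / δTV := by positivity
  unfold particleCount updateConst
  split_ifs
  · calc ((1 : ℕ) : ℝ) * T = δTV * (T / δTV) := by field_simp; simp
      _ ≤ c * (1 + T / δTV) ^ 3 := by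
        gcongr
        nlinarith [pow_nonneg hR 2, pow_nonneg hR 3]
      _ ≤ _ := by
        gcongr
        have : 0 ≤ A * (c ^ 2 + 1) + c ^ 2 := by positivity
        linarith
  · refine (ceil_mul_le hA hT hδ hδc).trans ?_
    have : 0 ≤ A * (c ^ 2 + 1) + c ^ 2 := by positivity
    gcongr ?_ * ?_
    · linarith
    · nlinarith [pow_nonneg hR 2, pow_nonneg hR 3]

lemma particleCount_mul_le (hA : 0 ≤ A) (hε : 0 ≤ ε) (hT : 1 ≤ T) (hδ : 0 < δTV)
    (hδc : δTV ≤ c) :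
    (particleCount A ε δTV T : ℝ) * T ≤ updateConst A c * (ε * T ^ 5 / δTV ^ 3 + T) := by
  have hc : 0 < c := hδ.trans_le hδc
  have hT' : (1 : ℝ) ≤ T := mod_cast hT
  unfold particleCount
  split_ifs with h
  · calc ((1 : ℕ) : ℝ) * T = 1 * (0 + T) := by simp
      _ ≤ _ := by
        have := one_le_updateConst hA hc.le
        gcongr
        positivity
  · have sq_le : (T / δTV) ^ 2 ≤ 4 * (ε * T ^ 5 / δTV ^ 3) := by
      rw [div_pow, mul_div_assoc', div_le_div_iff₀ (by positivity) (by positivity)]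
      calc (T : ℝ) ^ 2 * δTV ^ 3 = T ^ 2 * 1 * δTV ^ 2 * δTV := by ring
        _ ≤ T ^ 2 * T ^ 2 * δTV ^ 2 * (4 * (ε * T)) := by
          gcongr
          exacts [one_le_pow₀ hT', by linarith]
        _ = _ := by ring
    calc _ ≤ (A * (c ^ 2 + 1) + c ^ 2) * (T / δTV) ^ 2 := ceil_mul_le hA hT hδ hδc
      _ ≤ (A * (c ^ 2 + 1) + c ^ 2) * (4 * (ε * T ^ 5 / δTV ^ 3)) := by gcongr
      _ = 4 * (A * (c ^ 2 + 1) + c ^ 2) * (ε * T ^ 5 / δTV ^ 3 + 0) := by ring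
      _ ≤ _ := by
        unfold updateConst
        gcongr
        exacts [by linarith, by positivity]

lemma le_particleCount (hA : 0 ≤ A) (hδ : 0 < δTV) (h : δTV / 4 < ε * T) :
    A * T ≤ particleCount A ε δTV T ∧ A * T ≤ δTV ^ 2 * particleCount A ε δTV T := by
  have le_ceil := Nat.le_ceil (A * T * (1 + 1 / δTV ^ 2))
  rw [particleCount, if_neg h.not_ge]
  constructor
  · have : 0 ≤ A * T * (1 / δTV ^ 2) := by positivity
    linarith
  · calc A * T ≤ δTV ^ 2 * (A * T) + A * T := le_add_of_nonneg_left (by positivity)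
      _ = δTV ^ 2 * (A * T * (1 + 1 / δTV ^ 2)) := by field_simp
      _ ≤ _ := by gcongr

end ParticleCount

lemma Model.tvDist_target_smc_particleCount_le {S : ℕ → Type u} {m : Model S} {s₀ : S 0} {T : ℕ}
    {L ε c K δTV δ : ℝ} (hR : m.RatioBound s₀ T L) (hB : m.BellmanBound s₀ T ε) (hε : 0 ≤ ε)
    (hL : 1 ≤ L) (hT : 1 ≤ T) (hεT : ε * T ≤ c) (hδTV : 0 < δTV) (hδ0 : 0 < δ) (hδ1 : δ ≤ 1)
    (hK : 1 ≤ K) (hδK : 2 * δ ≤ K * δTV) {N : ℕ} [NeZero N]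
    (hN : N = particleCount (12 * Real.exp c ^ 8) ε δTV T) :
    tvDist (m.target s₀ T)
      ((m.smc s₀ T N ⌈L⌉₊ (4 * (L * (1 + c))) (δ / (K * N * T))).map Run.out) ≤ δTV := by
  have hT' : (1 : ℝ) ≤ T := mod_cast hT
  have hN' : (1 : ℝ) ≤ N := mod_cast NeZero.one_le
  have hLB : L * (1 + ε) ≤ L * (1 + c) := by
    gcongr
    exact (le_mul_of_one_le_right hε hT').trans hεT
  have one_le_KNT : 1 ≤ K * N * T :=
    one_le_mul_of_one_le_of_one_le (one_le_mul_of_one_le_of_one_le hK hN') hT'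
  have failure_pos : 0 < δ / (K * N * T) := by positivity
  have failure_le_one : δ / (K * N * T) ≤ 1 :=
    div_le_one_of_le₀ (hδ1.trans one_le_KNT) (by linarith)
  have total_failure_le : δ / (K * N * T) * (N * T) ≤ δTV / 2 := by
    rw [mul_assoc K, div_mul_eq_mul_div, mul_div_mul_right _ _ (by positivity),
      div_le_div_iff₀ (by positivity) two_pos]
    linarith
  rcases le_or_gt (ε * T) (δTV / 4) with h | h
  · obtain rfl : N = 1 := by rw [hN, particleCount, if_pos h]
    refine (tvDist_target_smc_one_le hR hB hε hLB failure_pos failure_le_one ⌈L⌉₊).trans ?_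
    linarith
  · obtain ⟨le_N, le_sq_N⟩ := le_particleCount (A := 12 * Real.exp c ^ 8) (by positivity) hδTV h
    rw [← hN] at le_N le_sq_N
    have : NeZero ⌈L⌉₊ := ⟨(Nat.ceil_pos.2 (by linarith)).ne'⟩
    refine (tvDist_target_smc_le_of_le_card hR hB hε hLB failure_pos failure_le_one hεT
      (Nat.le_ceil L) hδTV (le_trans ?_ le_N) le_sq_N).trans (by linarith)
    gcongr
    norm_num

section RunningTime
variable {S : ℕ → Type u} {T N Nm n : ℕ}

lemma histTime_le (t : ℕ) (h : Hist S N Nm n t) :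
    histTime t h ≤ t * (N * (5 * n + 2 * Nm + 4)) := by
  induction t with
  | zero => exact Nat.zero_le _
  | succ t ih =>
    obtain ⟨h, r⟩ := h
    have rs_le : ∑ i, (r.rs i).time ≤ N * (5 * n + 1) :=
      (Finset.sum_le_sum fun i _ => (r.rs i).time_le).trans_eq (by simp)
    calc histTime t h + r.time
        ≤ t * (N * (5 * n + 2 * Nm + 4)) + (N * (5 * n + 1) + N * (2 * Nm + 2) + N) := by
          unfold Round.time
          gcongr
          exact ih h
      _ = _ := by ring

lemma Run.time_le (ω : Run S T N Nm n) : ω.time ≤ T * N * (5 * n + 2 * Nm + 4) + 1 := by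
  rw [Run.time, mul_assoc]
  exact Nat.succ_le_succ (histTime_le T ω.1)

lemma half_le_log_one_div {δ : ℝ} (hδ0 : 0 < δ) (hδ1 : δ ≤ 1 / 2) :
    1 / 2 ≤ Real.log (1 / δ) := by
  have log_two_le : Real.log 2 ≤ Real.log (1 / δ) :=
    Real.log_le_log two_pos (by rw [le_div_iff₀ hδ0]; linarith)
  linarith [Real.log_two_gt_d9]

/-- The constant in the bound `log_four_div_le` on the logarithm that enters the budget of rejection
sampling. -/
noncomputable def logConst (K D : ℝ) : ℝ := 2 * (Real.log (4 * K * D) + 3) + 1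

lemma log_four_div_le {K D R x δ : ℝ} (hK : 1 ≤ K) (hD : 1 ≤ D) (hR : 0 ≤ R) (hx : 0 < x)
    (hxR : x ≤ D * (1 + R) ^ 3) (hδ0 : 0 < δ) (hδ1 : δ ≤ 1 / 2) :
    Real.log (4 / (δ / (K * x))) ≤
      logConst K D * ((1 + Real.log (1 + R)) * Real.log (1 / δ)) := by
  have hr : 0 ≤ Real.log (1 + R) := Real.log_nonneg (by linarith)
  have hl := half_le_log_one_div hδ0 hδ1
  have hKD : 0 ≤ Real.log (4 * K * D) := Real.log_nonneg (by nlinarith)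
  have log_le : Real.log (4 * K * x) ≤ Real.log (4 * K * D) + 3 * Real.log (1 + R) := calc
    Real.log (4 * K * x) ≤ Real.log (4 * K * (D * (1 + R) ^ 3)) := by gcongr
    _ = _ := by
      rw [← mul_assoc, Real.log_mul (by positivity) (by positivity), Real.log_pow]
      norm_num
  have div_eq : 4 / (δ / (K * x)) = 4 * K * x * (1 / δ) := by field_simp
  rw [div_eq, Real.log_mul (by positivity) (by positivity), logConst]
  set r := Real.log (1 + R)
  set l := Real.log (1 / δ)
  set G := Real.log (4 * K * D)
  calc _ ≤ G + 3 * r + l := by gcongr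
    _ ≤ (G + 3) * (1 + r) * 1 + 1 * l := by linarith [mul_nonneg hKD hr]
    _ ≤ (G + 3) * (1 + r) * (2 * l) + (1 + r) * l := by gcongr <;> linarith
    _ = _ := by ring

lemma Run.time_le_of_log_le {L c G P δ' : ℝ} (hT : 1 ≤ T) (hN : 1 ≤ N) (hc : 0 ≤ c) (hL : 1 ≤ L)
    (hδ0 : 0 < δ') (hδ1 : δ' ≤ 1) (hP : 1 / 2 ≤ P) (hlog : Real.log (4 / δ') ≤ G * P)
    (ω : Run S T N ⌈L⌉₊ (rsBudget (4 * (L * (1 + c))) δ')) :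
    (ω.time : ℝ) ≤ (80 * (1 + c) * G + 28) * (N * T) * (L * P) := by
  have hNT : (1 : ℝ) ≤ N * T := mod_cast Nat.mul_pos hN hT
  have hLP : L ≤ 2 * (L * P) := by nlinarith
  have log_nonneg : 0 ≤ Real.log (4 / δ') :=
    Real.log_nonneg (by rw [le_div_iff₀ hδ0]; linarith)
  have ceil_le : (⌈L⌉₊ : ℝ) ≤ L + 1 := (Nat.ceil_lt_add_one (by linarith)).le
  have budget_le : (rsBudget (4 * (L * (1 + c))) δ' : ℝ) ≤ 16 * (1 + c) * G * (L * P) + 1 := calc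
    _ ≤ 4 * (4 * (L * (1 + c))) * Real.log (4 / δ') + 1 :=
        (Nat.ceil_lt_add_one (by positivity)).le
    _ ≤ 4 * (4 * (L * (1 + c))) * (G * P) + 1 := by gcongr
    _ = _ := by ring
  calc (ω.time : ℝ)
      ≤ T * N * (5 * rsBudget (4 * (L * (1 + c))) δ' + 2 * ⌈L⌉₊ + 4) + 1 := mod_cast ω.time_le
    _ ≤ T * N * ((80 * (1 + c) * G + 26) * (L * P)) + N * T * (2 * (L * P)) := by
      gcongr
      · linarith
      · nlinarith
    _ = _ := by ring

/-- The constant `C` of the running time bound. -/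
noncomputable def timeConst (A c₁ c₂ K : ℝ) : ℝ :=
  (80 * (1 + c₁) * logConst K (updateConst A c₂) + 28) * updateConst A c₂

lemma logConst_nonneg {K D : ℝ} (hK : 1 ≤ K) (hD : 1 ≤ D) : 0 ≤ logConst K D := by
  have : 0 ≤ Real.log (4 * K * D) := Real.log_nonneg (by nlinarith)
  unfold logConst
  positivity

lemma timeConst_pos {A c₁ c₂ K : ℝ} (hA : 0 ≤ A) (hc₁ : 0 ≤ c₁) (hc₂ : 0 ≤ c₂) (hK : 1 ≤ K) :
    0 < timeConst A c₁ c₂ K := by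
  have hD := one_le_updateConst hA hc₂
  have := logConst_nonneg hK hD
  unfold timeConst
  positivity

lemma Run.time_le_timeConst {A c₁ c₂ K L ε δTV δ : ℝ} (hA : 0 < A) (hc₁ : 0 ≤ c₁) (hK : 1 ≤ K)
    (hL : 1 ≤ L) (hε : 0 ≤ ε) (hT : 1 ≤ T) (hδTV : 0 < δTV) (hδTV₂ : δTV ≤ c₂) (hδ0 : 0 < δ)
    (hδ1 : δ ≤ 1 / 2) (hN : N = particleCount A ε δTV T)
    (ω : Run S T N ⌈L⌉₊ (rsBudget (4 * (L * (1 + c₁))) (δ / (K * N * T)))) :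
    (ω.time : ℝ) ≤ timeConst A c₁ c₂ K * (1 + Real.log (1 + T / δTV)) ^ 1 *
      ((ε * L * T ^ 5 / δTV ^ 3 + L * T) * Real.log (1 / δ)) := by
  have hN1 : 1 ≤ N := hN ▸ particleCount_pos hA hT
  have hNT : (1 : ℝ) ≤ N * T := mod_cast Nat.mul_pos hN1 hT
  have hD := one_le_updateConst hA.le (hδTV.le.trans hδTV₂)
  have hR : 0 ≤ T / δTV := by positivity
  have cube_le := particleCount_mul_le_cube (ε := ε) hA.le hT hδTV hδTV₂
  have count_le := particleCount_mul_le hA.le hε hT hδTV hδTV₂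
  rw [← hN] at cube_le count_le
  have log_le := log_four_div_le hK hD hR (by linarith) cube_le hδ0 hδ1
  have hl := half_le_log_one_div hδ0 hδ1
  have hr : 0 ≤ Real.log (1 + T / δTV) := Real.log_nonneg (by linarith)
  have hG := logConst_nonneg hK hD
  have failure_le_one : δ / (K * (N * T)) ≤ 1 :=
    div_le_one_of_le₀ (by nlinarith) (by positivity)
  rw [← mul_assoc] at log_le failure_le_one
  have hP : 1 / 2 ≤ (1 + Real.log (1 + T / δTV)) * Real.log (1 / δ) := by nlinarith
  refine (ω.time_le_of_log_le hT hN1 hc₁ hL (by positivity) failure_le_one hP log_le).trans ?_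
  grw [count_le]
  rw [timeConst]
  exact le_of_eq (by ring)

end RunningTime

lemma filter_univ {α : Type*} (p : PMF α) (h : ∃ a ∈ Set.univ, a ∈ p.support) :
    p.filter Set.univ h = p := by
  ext a
  rw [PMF.filter_apply, Set.indicator_univ, p.tsum_coe, inv_one, mul_one]

end OptSMC

theorem mainTheorem9 :
    ∀ c₁ c₂ c₃ : ℝ, 0 < c₁ → 0 < c₂ → 0 < c₃ →
    ∃ (C K : ℝ) (k : ℕ), 0 < C ∧ 1 ≤ K ∧
    ∀ (T : ℕ) (ε L δTV δ : ℝ), 1 ≤ T → 0 ≤ ε → ε ≤ c₁ / T → 1 ≤ L →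
      0 < δTV → δTV ≤ c₂ → 0 < δ → δ ≤ c₃ * δTV → δ ≤ 1 / 2 →
    ∃ (N Nm : ℕ) (M : ℝ) (_ : NeZero N), 0 < Nm ∧ 0 < M ∧
    ∀ (S : ℕ → Type u) (m : OptSMC.Model S) (s₀ : S 0),
      m.RatioBound s₀ T L → m.BellmanBound s₀ T ε →
      (∀ ω : OptSMC.Run S T N Nm (OptSMC.rsBudget M (δ / (K * N * T))),
        (OptSMC.Run.time ω : ℝ) ≤
          C * (1 + Real.log (1 + T / δTV)) ^ k *
            ((ε * L * T ^ 5 / δTV ^ 3 + L * T) * Real.log (1 / δ))) ∧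
      ∃ (E : Set (OptSMC.Run S T N Nm (OptSMC.rsBudget M (δ / (K * N * T)))))
        (hE : ∃ ω ∈ E, ω ∈ (m.smc s₀ T N Nm M (δ / (K * N * T))).support),
        1 - δ ≤ ((m.smc s₀ T N Nm M (δ / (K * N * T))).toOuterMeasure E).toReal ∧
        OptSMC.tvDist (m.target s₀ T)
          (((m.smc s₀ T N Nm M (δ / (K * N * T))).filter E hE).map OptSMC.Run.out) ≤ δTV := by
  intro c₁ c₂ c₃ hc₁ hc₂ hc₃
  refine ⟨OptSMC.timeConst (12 * Real.exp c₁ ^ 8) c₁ c₂ (1 + 2 * c₃), 1 + 2 * c₃, 1,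
    OptSMC.timeConst_pos (by positivity) hc₁.le hc₂.le (by linarith), by linarith, ?_⟩
  intro T ε L δTV δ hT hε hεT hL hδTV hδTV₂ hδ hδ₃ hδ₁
  obtain ⟨N, hN⟩ : ∃ N, N = OptSMC.particleCount (12 * Real.exp c₁ ^ 8) ε δTV T := ⟨_, rfl⟩
  have : NeZero N := ⟨(hN ▸ OptSMC.particleCount_pos (by positivity) hT).ne'⟩
  refine ⟨N, ⌈L⌉₊, 4 * (L * (1 + c₁)), this, Nat.ceil_pos.2 (by linarith), by positivity,
    fun S m s₀ hR hB => ⟨fun ω => ?_, Set.univ, ?_, ?_, ?_⟩⟩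
  · exact ω.time_le_timeConst (by positivity) hc₁.le (by linarith) hL hε hT hδTV hδTV₂ hδ hδ₁ hN
  · obtain ⟨ω, hω⟩ := (m.smc s₀ T N ⌈L⌉₊ (4 * (L * (1 + c₁)))
      (δ / ((1 + 2 * c₃) * N * T))).support_nonempty
    exact ⟨ω, trivial, hω⟩
  · rw [(PMF.toOuterMeasure_apply_eq_one_iff _ _).2 (Set.subset_univ _), ENNReal.toReal_one]
    linarith
  -- A failure of rejection sampling costs no more in total variation than its probability, so the
  -- bound holds for the unconditional law of the output and the sure event serves as `E`.
  · rw [OptSMC.filter_univ]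
    exact OptSMC.Model.tvDist_target_smc_particleCount_le hR hB hε hL hT
      ((le_div_iff₀ (by positivity)).1 hεT) hδTV hδ (by linarith) (by linarith) (by nlinarith) hN
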